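/- **Conventions.** Let $\overline{\mathbb R}=[-\infty,+\infty]$, $\mathrm{dom}(f)=\{x\mid f(x)<+\infty\}$, $f^*(w)=\sup_x\{x^\top w-f(x)\}$ and $\delta^*_A(w)=\sup_{x\in A}x^\top w$. A function is *closed* if it is lower semicontinuous and is either nowhere $-\infty$ or identically $-\infty$; it is *proper* if it is nowhere $-\infty$ and not identically $+\infty$. For a proper, closed and convex $f$, $t f(x/t)$ denotes, for $t\ge 0$, the perspective that equals $t\cdot f(x/t)$ if $t>0$ and $\delta^*_{\mathrm{dom}(f^*)}(x)$ if $t=0$ (it is set to $+\infty$ for $t<0$); for $f$ with $-f$ proper, closed and convex, $tf(x/t):=-\,[\,t(-f)(x/t)\,]$. A point is *feasible* in a minimization (maximization) problem if it satisfies the constraints and has objective value $\neq+\infty$ ($\neq-\infty$). A point *solves* a problem if it is feasible and attains the optimal value, or if the problem has no feasible point; a problem is *solvable* if some point solves it. A *Slater point* of a problem with constraints $f_k\le 0$, $e_m=0$ and objective $f_0$ is a point that satisfies all constraints, lies in the relative interiors of the domains of all $f_k$, all $e_m$ and $f_0$ (of $-f_0$ for a maximization problem), and satisfies $f_k<0$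 for every $k$ for which $f_k$ is not linear (affine). Here sign constraints $\lambda\ge0$ count as linear constraints, and a function involving perspectives is linear if it coincides with a real-valued affine function wherever the sign-constrained variables are nonnegative. **Setting.** Let $\mathcal I=\{1,\dots,I\}$ with $I\ge 1$, and let $\mathcal J,\mathcal L$ be finite index sets. Let $-g_i$ ($i\in\mathcal I$), $h_j$ ($j\in\mathcal J$) and $c_\ell$ ($\ell\in\mathcal L$) be proper, closed and convex functions $\mathbb R^{d}\to\overline{\mathbb R}$, and let $\mu\in\mathbb R^{\mathcal J}$. Put $g=\max_{i}g_i$, $h=(h_j)_j$, $S=\{z\mid c_\ell(z)\le 0\ \forall \ell\}$, $$\bar S_i=\{z\in S\mid h_j(z)<+\infty\ \forall j,\ g_i(z)>-\infty\},\qquad \bar S=\bigcup_{i}\bar S_i,$$ $$U_i=\{(z,u,t)\in\mathbb R^d\times\mathbb R^{\mathcal J}\times\mathbb R\mid c_\ell(z)\le0\ \forall\ell,\ h(z)\le u,\ g_i(z)\ge t\},$$ and assume that $\bar S_i\ne\emptyset$ for every $i\in\mathcal I$. Let $\mathcal P$ be the set of Borel probability distributions $\mathbb P$ on $\mathbb R^d$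 with $\mathbb P(S)=1$ and $\mathbb E_{\mathbb P}[h_j]\le\mu_j$ for all $j$, where $\mathbb E_{\mathbb P}[h_j]:=+\infty$ and $\mathbb E_{\mathbb P}[g]:=-\infty$ if the expectations of the positive and the negative part are both infinite. Consider the following problems. - (P-UQ) $\ \sup_{\mathbb P\in\mathcal P}\mathbb E_{\mathbb P}[g]$. - (D-UQ) $\ \inf\{\alpha+\mu^\top\beta\mid \sup_{z\in\bar S}\{g(z)-\alpha-h(z)^\top\beta\}\le 0,\ \alpha\in\mathbb R,\ \beta\ge0\}$. - (FR) $\ \sup\{\sum_i\lambda_i g(z_i)\mid \sum_i\lambda_i=1,\ \sum_i\lambda_i h(z_i)\le\mu,\ z_i\in\bar S\ \forall i,\ \lambda\ge0\}$. - (AP-W) $\ \inf\{\alpha+\mu^\top\beta\mid \sup_{(z,u,t)\in U_i}\{t-\alpha-u^\top\beta\}\le0\ \forall i,\ \alpha\in\mathbb R,\ \beta\ge0\}$. - (AD-B) $\ \sup\{\sum_i\lambda_it_i\mid \sum_i\lambda_i=1,\ \sum_i\lambda_iu_i\le\mu,\ (z_i,u_i,t_i)\in U_i\ \forall i,\ \lambda\ge0\}$.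 - (AP-W$'$) $\ \inf\ \alpha+\mu^\top\beta$ over $\alpha\in\mathbb R$, $\beta\ge0$, $y^{(0)}_i,y^{(1)}_{ij},y^{(2)}_{i\ell}\in\mathbb R^d$, $\nu_{i\ell}\ge0$ subject to, for all $i\in\mathcal I$, $y_i^{(0)}+\sum_jy_{ij}^{(1)}+\sum_\ell y_{i\ell}^{(2)}=0$ and $$(-g_i)^*(y_i^{(0)})+\sum_j\beta_jh_j^*\big(y_{ij}^{(1)}/\beta_j\big)+\sum_\ell\nu_{i\ell}c_\ell^*\big(y^{(2)}_{i\ell}/\nu_{i\ell}\big)\le\alpha .$$ - (AD-B$'$) $\ \sup\ \sum_i\tau_i$ over $\tau\in\mathbb R^{\mathcal I}$, $\lambda\ge0$, $\omega_i\in\mathbb R^{\mathcal J}$, $\upsilon_i\in\mathbb R^d$ subject to $\sum_i\lambda_i=1$, $\sum_i\omega_i\le\mu$ and, for all $i\in\mathcal I$ and $\ell\in\mathcal L$, $\lambda_ic_\ell(\upsilon_i/\lambda_i)\le0$, $\lambda_ih(\upsilon_i/\lambda_i)\le\omega_i$, $\lambda_ig_i(\upsilon_i/\lambda_i)\ge\tau_i$.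 **Theorem (Strong Duality for (P-UQ) and (D-UQ)).** (i) If (AD-B$'$) admits a Slater point with $\lambda>0$, then (AP-W$'$), (AP-W), (D-UQ), (P-UQ), (FR), (AD-B) and (AD-B$'$) all have the same optimal value in $\overline{\mathbb R}$, and (AP-W$'$) is solvable. Moreover, if $(\alpha^\star,\beta^\star,\{y_i^{(0)\star}\}_i,\{y_{ij}^{(1)\star}\}_{ij},\{y_{i\ell}^{(2)\star},\nu_{i\ell}^\star\}_{i\ell})$ solves (AP-W$'$), then $(\alpha^\star,\beta^\star)$ solves (D-UQ). (ii) If (AP-W$'$) admits a Slater point and $S$ is bounded, then (AP-W$'$), (AP-W), (D-UQ), (P-UQ), (FR), (AD-B) and (AD-B$'$) all have the same optimal value in $\overline{\mathbb R}$, and (AD-B$'$) is solvable. Moreover, if $(\tau^\star,\lambda^\star,\{\omega_i^\star,\upsilon_i^\star\}_i)$ solves (AD-B$'$), then the discrete distribution $\sum_{i:\lambda_i^\star>0}\lambda_i^\star\,\delta_{\upsilon_i^\star/\lambda_i^\star}$ solves (P-UQ) (where $\delta_x$ is the unit mass at $x$). -/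

import Mathlib

open MeasureTheory

namespace UQ

/-! ### Convex analysis for extended real-valued functions -/

section ConvexAnalysis

/-- The effective domain of an extended real-valued function. -/
def dom {X : Type*} (f : X → EReal) : Set X := {x | f x < ⊤}

/-- The epigraph, a subset of `X × ℝ`. -/
def epigraph {X : Type*} (f : X → EReal) : Set (X × ℝ) := {p | f p.1 ≤ (p.2 : EReal)}

/-- `f` never takes the value `-∞` and is not identically `+∞`. -/
def IsProper {X : Type*} (f : X → EReal) : Prop := (∀ x, ⊥ < f x) ∧ ∃ x, f x < ⊤

/-- `f` is lower semicontinuous and either nowhere `-∞` or identically `-∞`. -/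
def IsClosedFun {X : Type*} [TopologicalSpace X] (f : X → EReal) : Prop :=
  LowerSemicontinuous f ∧ ((∀ x, ⊥ < f x) ∨ ∀ x, f x = ⊥)

/-- Convexity of an extended real-valued function: its epigraph is convex. -/
def IsConvexFun {X : Type*} [AddCommGroup X] [Module ℝ X] (f : X → EReal) : Prop :=
  Convex ℝ (epigraph f)

/-- Proper, closed and convex. -/
structure IsPCC {X : Type*} [TopologicalSpace X] [AddCommGroup X] [Module ℝ X]
    (f : X → EReal) : Prop where
  proper : IsProper f
  closed : IsClosedFun f
  convex : IsConvexFun f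

/-- The conjugate `f^*(w) = sup_x { xᵀw - f(x) }`. -/
noncomputable def conj {d : ℕ} (f : EuclideanSpace ℝ (Fin d) → EReal)
    (w : EuclideanSpace ℝ (Fin d)) : EReal :=
  ⨆ x, (((inner ℝ x w : ℝ) : EReal) - f x)

/-- The support function `w ↦ sup_{x ∈ A} xᵀw` of a set. -/
noncomputable def supportFun {d : ℕ} (A : Set (EuclideanSpace ℝ (Fin d)))
    (w : EuclideanSpace ℝ (Fin d)) : EReal :=
  ⨆ x ∈ A, ((inner ℝ x w : ℝ) : EReal)

/-- The convex perspective: `t f(x / t)` for `t > 0` and the support function of `dom f^*`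
for `t = 0`. It is only meaningful for `t ≥ 0` and is extended by `+∞` to `t < 0`. -/
noncomputable def persp {d : ℕ} (f : EuclideanSpace ℝ (Fin d) → EReal)
    (x : EuclideanSpace ℝ (Fin d)) (t : ℝ) : EReal :=
  if 0 < t then (t : EReal) * f (t⁻¹ • x)
  else if t = 0 then supportFun (dom (conj f)) x
  else ⊤

/-- The concave perspective: `t f(x / t)` for `t > 0` and minus the support function of
`dom (-f)^*` for `t = 0`; it is extended by `-∞` to `t < 0`. -/
noncomputable def concavePersp {d : ℕ} (f : EuclideanSpace ℝ (Fin d) → EReal)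
    (x : EuclideanSpace ℝ (Fin d)) (t : ℝ) : EReal :=
  -persp (fun z => -f z) x t

end ConvexAnalysis

/-! ### Optimization problems -/

section Optimization

/-- Optimal value of `inf { f x | x ∈ C }`. -/
noncomputable def minValue {X : Type*} (C : Set X) (f : X → EReal) : EReal := ⨅ x ∈ C, f x

/-- Optimal value of `sup { f x | x ∈ C }`. -/
noncomputable def maxValue {X : Type*} (C : Set X) (f : X → EReal) : EReal := ⨆ x ∈ C, f x

/-- `x` is feasible in `inf { f x | x ∈ C }`. -/
def FeasibleMin {X : Type*} (C : Set X) (f : X → EReal) (x : X) : Prop := x ∈ C ∧ f x ≠ ⊤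

/-- `x` is feasible in `sup { f x | x ∈ C }`. -/
def FeasibleMax {X : Type*} (C : Set X) (f : X → EReal) (x : X) : Prop := x ∈ C ∧ f x ≠ ⊥

/-- `x` solves `inf { f x | x ∈ C }`: if the problem is feasible, then `x` is feasible and attains
the optimal value; an infeasible problem is solved by every `x`. -/
def SolvesMin {X : Type*} (C : Set X) (f : X → EReal) (x : X) : Prop :=
  (∃ x', FeasibleMin C f x') → FeasibleMin C f x ∧ f x = minValue C f

/-- `x` solves `sup { f x | x ∈ C }`, with the same convention for infeasible problems. -/
def SolvesMax {X : Type*} (C : Set X) (f : X → EReal) (x : X) : Prop :=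
  (∃ x', FeasibleMax C f x') → FeasibleMax C f x ∧ f x = maxValue C f

/-- A representation of a set by inequalities `ineq k x ≤ 0` and equalities `eqn k x = 0`.
`ground` is the set of those `x` whose sign-constrained components are nonnegative: perspective
functions are only defined there. The sign constraints themselves are listed among the
inequalities. -/
structure Constraints (X : Type*) (K M : Type*) where
  ground : Set X
  ineq : K → X → EReal
  eqn : M → X → EReal

variable {X K M : Type*}

/-- The set represented by the constraints. -/
def Constraints.set (C : Constraints X K M) : Set X :=
  {x | (∀ k, C.ineq k x ≤ 0) ∧ ∀ m, C.eqn m x = 0}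

/-- `f` is linear (that is, real-valued and affine) on the set on which it is defined. -/
def IsLinearOn [AddCommGroup X] [Module ℝ X] (A : Set X) (f : X → EReal) : Prop :=
  ∃ a : X →ᵃ[ℝ] ℝ, ∀ x ∈ A, f x = ((a x : ℝ) : EReal)

/-- Slater point of a set represented by constraints. -/
structure Constraints.IsSlaterPoint [AddCommGroup X] [Module ℝ X] [TopologicalSpace X]
    (C : Constraints X K M) (x : X) : Prop where
  ri_ineq : ∀ k, x ∈ intrinsicInterior ℝ (dom (C.ineq k))
  ri_eqn : ∀ m, x ∈ intrinsicInterior ℝ (dom (C.eqn m))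
  mem : x ∈ C.set
  strict : ∀ k, ¬ IsLinearOn C.ground (C.ineq k) → C.ineq k x < 0

/-- Slater point of the minimization problem `inf { f x | x ∈ C }`. -/
def IsSlaterPointMin [AddCommGroup X] [Module ℝ X] [TopologicalSpace X]
    (C : Constraints X K M) (f : X → EReal) (x : X) : Prop :=
  C.IsSlaterPoint x ∧ x ∈ intrinsicInterior ℝ (dom f)

/-- Slater point of the maximization problem `sup { f x | x ∈ C }`. -/
def IsSlaterPointMax [AddCommGroup X] [Module ℝ X] [TopologicalSpace X]
    (C : Constraints X K M) (f : X → EReal) (x : X) : Prop :=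
  C.IsSlaterPoint x ∧ x ∈ intrinsicInterior ℝ (dom fun y => -f y)

end Optimization

/-! ### Expectations of extended real-valued functions -/

section Expectation

variable {Ω : Type*} [MeasurableSpace Ω]

/-- Expectation with value `-∞` if the positive and the negative part both have infinite
expectation. -/
noncomputable def expectBot (P : Measure Ω) (f : Ω → EReal) : EReal :=
  if (∫⁻ z, (f z).toENNReal ∂P) = ⊤ ∧ (∫⁻ z, (-f z).toENNReal ∂P) = ⊤ then ⊥
  else ((∫⁻ z, (f z).toENNReal ∂P : ENNReal) : EReal)
    - ((∫⁻ z, (-f z).toENNReal ∂P : ENNReal) : EReal)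

/-- Expectation with value `+∞` if the positive and the negative part both have infinite
expectation. -/
noncomputable def expectTop (P : Measure Ω) (f : Ω → EReal) : EReal :=
  if (∫⁻ z, (f z).toENNReal ∂P) = ⊤ ∧ (∫⁻ z, (-f z).toENNReal ∂P) = ⊤ then ⊤
  else ((∫⁻ z, (f z).toENNReal ∂P : ENNReal) : EReal)
    - ((∫⁻ z, (-f z).toENNReal ∂P : ENNReal) : EReal)

end Expectation

/-! ### The uncertainty quantification problems -/

/-- Data of an uncertainty quantification problem on `ℝ^d`: the pieces `g i` of the disutility
function, the moment functions `h j`, the functions `c l` that describe the support set, and the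
moment bounds `mu`. -/
structure Data (d : ℕ) (I J L : Type*) where
  g : I → EuclideanSpace ℝ (Fin d) → EReal
  h : J → EuclideanSpace ℝ (Fin d) → EReal
  c : L → EuclideanSpace ℝ (Fin d) → EReal
  mu : J → ℝ

namespace Data

variable {d : ℕ} {I J L : Type*} [Fintype I] [Fintype J] [Fintype L] (D : Data d I J L)

/-- The disutility function `g(z) = max_i g_i(z)`. -/
noncomputable def disutility (z : EuclideanSpace ℝ (Fin d)) : EReal := ⨆ i, D.g i z

/-- The support set `S`. -/
def support : Set (EuclideanSpace ℝ (Fin d)) := {z | ∀ l, D.c l z ≤ 0}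

/-- The set `S̄_i`. -/
def effSupportPiece (i : I) : Set (EuclideanSpace ℝ (Fin d)) :=
  {z | z ∈ D.support ∧ (∀ j, z ∈ dom (D.h j)) ∧ z ∈ dom (fun y => -D.g i y)}

/-- The effective support set `S̄ = ⋃ i, S̄_i`. -/
def effSupport : Set (EuclideanSpace ℝ (Fin d)) := ⋃ i, D.effSupportPiece i

/-- The ambiguity set: probability distributions supported on `S` that obey the moment bounds. -/
def ambiguitySet : Set (Measure (EuclideanSpace ℝ (Fin d))) :=
  {P | IsProbabilityMeasure P ∧ P D.supportᶜ = 0 ∧ ∀ j, expectTop P (D.h j) ≤ (D.mu j : EReal)}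

/-- Objective function of (P-UQ). -/
noncomputable def puqObj (P : Measure (EuclideanSpace ℝ (Fin d))) : EReal :=
  expectBot P D.disutility

/-- Constraints of (D-UQ) on `(α, β)`. -/
def duqSet : Set (ℝ × (J → ℝ)) :=
  {x | (⨆ z ∈ D.effSupport,
        (D.disutility z - (x.1 : EReal) - ∑ j, D.h j z * (x.2 j : EReal))) ≤ 0 ∧
      ∀ j, 0 ≤ x.2 j}

/-- Objective function `α + μᵀβ` of (D-UQ) and (AP-W). -/
noncomputable def duqObj (x : ℝ × (J → ℝ)) : EReal :=
  ((x.1 + ∑ j, D.mu j * x.2 j : ℝ) : EReal)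

/-- Constraints of (FR) on `(λ, z)`. -/
def frSet : Set ((I → ℝ) × (I → EuclideanSpace ℝ (Fin d))) :=
  {x | ∑ i, x.1 i = 1 ∧
      (∀ j, ∑ i, (x.1 i : EReal) * D.h j (x.2 i) ≤ (D.mu j : EReal)) ∧
      (∀ i, x.2 i ∈ D.effSupport) ∧ ∀ i, 0 ≤ x.1 i}

/-- Objective function of (FR). -/
noncomputable def frObj (x : (I → ℝ) × (I → EuclideanSpace ℝ (Fin d))) : EReal :=
  ∑ i, (x.1 i : EReal) * D.disutility (x.2 i)

/-- The augmented support set `U_i` of triples `(z, u, t)`. -/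
def augSupport (i : I) : Set (EuclideanSpace ℝ (Fin d) × (J → ℝ) × ℝ) :=
  {p | (∀ l, D.c l p.1 ≤ 0) ∧ (∀ j, D.h j p.1 ≤ (p.2.1 j : EReal)) ∧
      (p.2.2 : EReal) ≤ D.g i p.1}

/-- Constraints of (AP-W) on `(α, β)`. -/
def apwSet : Set (ℝ × (J → ℝ)) :=
  {x | (∀ i, (⨆ p ∈ D.augSupport i,
        ((p.2.2 - x.1 - ∑ j, p.2.1 j * x.2 j : ℝ) : EReal)) ≤ 0) ∧
      ∀ j, 0 ≤ x.2 j}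

/-- Constraints of (AD-B) on `(λ, {(z_i, u_i, t_i)}_i)`. -/
def adbSet : Set ((I → ℝ) × (I → EuclideanSpace ℝ (Fin d) × (J → ℝ) × ℝ)) :=
  {x | ∑ i, x.1 i = 1 ∧ (∀ j, ∑ i, x.1 i * (x.2 i).2.1 j ≤ D.mu j) ∧
      (∀ i, x.2 i ∈ D.augSupport i) ∧ ∀ i, 0 ≤ x.1 i}

/-- Objective function of (AD-B). -/
noncomputable def adbObj (_ : Data d I J L)
    (x : (I → ℝ) × (I → EuclideanSpace ℝ (Fin d) × (J → ℝ) × ℝ)) : EReal :=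
  ((∑ i, x.1 i * (x.2 i).2.2 : ℝ) : EReal)

end Data

/-! ### The finite convex program (AP-W') -/

/-- Decision variables `(α, β, y⁽⁰⁾, y⁽¹⁾, y⁽²⁾, ν)` of (AP-W'). -/
abbrev APWVar (d : ℕ) (I J L : Type*) :=
  ℝ × (J → ℝ) × (I → EuclideanSpace ℝ (Fin d)) × (I → J → EuclideanSpace ℝ (Fin d)) ×
    (I → L → EuclideanSpace ℝ (Fin d)) × (I → L → ℝ)

namespace APWVar

variable {d : ℕ} {I J L : Type*}

def alpha (x : APWVar d I J L) : ℝ := x.1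
def beta (x : APWVar d I J L) : J → ℝ := x.2.1
def y0 (x : APWVar d I J L) : I → EuclideanSpace ℝ (Fin d) := x.2.2.1
def y1 (x : APWVar d I J L) : I → J → EuclideanSpace ℝ (Fin d) := x.2.2.2.1
def y2 (x : APWVar d I J L) : I → L → EuclideanSpace ℝ (Fin d) := x.2.2.2.2.1
def nu (x : APWVar d I J L) : I → L → ℝ := x.2.2.2.2.2

end APWVar

/-- Names of the inequality constraints of (AP-W'). -/
inductive APWIneq (I J L : Type*)
  | piece (i : I)
  | betaSign (j : J)
  | nuSign (i : I) (l : L)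

/-! ### The finite convex program (AD-B') -/

/-- Decision variables `(τ, λ, ω, υ)` of (AD-B'). -/
abbrev ADBVar (d : ℕ) (I J : Type*) :=
  (I → ℝ) × (I → ℝ) × (I → J → ℝ) × (I → EuclideanSpace ℝ (Fin d))

namespace ADBVar

variable {d : ℕ} {I J : Type*}

def tau (x : ADBVar d I J) : I → ℝ := x.1
def lam (x : ADBVar d I J) : I → ℝ := x.2.1
def omega (x : ADBVar d I J) : I → J → ℝ := x.2.2.1
def ups (x : ADBVar d I J) : I → EuclideanSpace ℝ (Fin d) := x.2.2.2

end ADBVar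

/-- Names of the inequality constraints of (AD-B'). -/
inductive ADBIneq (I J L : Type*)
  | moment (j : J)
  | supp (i : I) (l : L)
  | momentPiece (i : I) (j : J)
  | disutilityPiece (i : I)
  | lamSign (i : I)

namespace Data

variable {d : ℕ} {I J L : Type*} [Fintype I] [Fintype J] [Fintype L] (D : Data d I J L)

/-- Inequality constraints of (AP-W'), each in the form `f(x) ≤ 0`. -/
noncomputable def apwIneq : APWIneq I J L → APWVar d I J L → EReal
  | .piece i, x =>
      conj (fun z => -D.g i z) (x.y0 i) + ∑ j, persp (conj (D.h j)) (x.y1 i j) (x.beta j)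
        + ∑ l, persp (conj (D.c l)) (x.y2 i l) (x.nu i l) - (x.alpha : EReal)
  | .betaSign j, x => ((-x.beta j : ℝ) : EReal)
  | .nuSign i l, x => ((-x.nu i l : ℝ) : EReal)

/-- Equality constraints of (AP-W'), one for every `i` and every coordinate `k` of `ℝ^d`. -/
noncomputable def apwEqn (_ : Data d I J L) (m : I × Fin d) (x : APWVar d I J L) : EReal :=
  (((x.y0 m.1 + ∑ j, x.y1 m.1 j + ∑ l, x.y2 m.1 l) m.2 : ℝ) : EReal)

/-- The constraints of (AP-W'). -/
noncomputable def apwConstraints : Constraints (APWVar d I J L) (APWIneq I J L) (I × Fin d) where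
  ground := {x | (∀ j, 0 ≤ x.beta j) ∧ ∀ i l, 0 ≤ x.nu i l}
  ineq := D.apwIneq
  eqn := D.apwEqn

/-- Objective function of (AP-W'). -/
noncomputable def apwCvxObj (x : APWVar d I J L) : EReal :=
  ((x.alpha + ∑ j, D.mu j * x.beta j : ℝ) : EReal)

/-- Inequality constraints of (AD-B'), each in the form `f(x) ≤ 0`. -/
noncomputable def adbIneq : ADBIneq I J L → ADBVar d I J → EReal
  | .moment j, x => ((∑ i, x.omega i j - D.mu j : ℝ) : EReal)
  | .supp i l, x => persp (D.c l) (x.ups i) (x.lam i)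
  | .momentPiece i j, x => persp (D.h j) (x.ups i) (x.lam i) - (x.omega i j : EReal)
  | .disutilityPiece i, x => (x.tau i : EReal) - concavePersp (D.g i) (x.ups i) (x.lam i)
  | .lamSign i, x => ((-x.lam i : ℝ) : EReal)

/-- The constraints of (AD-B'). -/
noncomputable def adbConstraints : Constraints (ADBVar d I J) (ADBIneq I J L) Unit where
  ground := {x | ∀ i, 0 ≤ x.lam i}
  ineq := D.adbIneq
  eqn := fun _ x => ((∑ i, x.lam i - 1 : ℝ) : EReal)

/-- Objective function of (AD-B'). -/
noncomputable def adbCvxObj (_ : Data d I J L) (x : ADBVar d I J) : EReal :=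
  ((∑ i, x.tau i : ℝ) : EReal)

/-- The discrete distribution that assigns probability `λ_i` to `υ_i / λ_i` for every `i` with
`λ_i > 0`. -/
noncomputable def discreteDist (_ : Data d I J L) (x : ADBVar d I J) :
    Measure (EuclideanSpace ℝ (Fin d)) :=
  ∑ i, if 0 < x.lam i then
    ENNReal.ofReal (x.lam i) • Measure.dirac ((x.lam i)⁻¹ • x.ups i) else 0

/-- The problems (AP-W'), (AP-W), (D-UQ), (P-UQ), (FR), (AD-B) and (AD-B') all have the same
optimal value. -/
def SameValues : Prop :=
  minValue D.apwConstraints.set D.apwCvxObj = minValue D.apwSet D.duqObj ∧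
  minValue D.apwSet D.duqObj = minValue D.duqSet D.duqObj ∧
  minValue D.duqSet D.duqObj = maxValue D.ambiguitySet D.puqObj ∧
  maxValue D.ambiguitySet D.puqObj = maxValue D.frSet D.frObj ∧
  maxValue D.frSet D.frObj = maxValue D.adbSet D.adbObj ∧
  maxValue D.adbSet D.adbObj = maxValue D.adbConstraints.set D.adbCvxObj

end Data

end UQ

/-!
Weak duality runs through the seven problems: a feasible point of (AP-W') bounds (D-UQ) by
Fenchel's inequality, (D-UQ) bounds (P-UQ) by integration, and (AD-B) embeds into (FR) and (FR)
into (P-UQ) as discrete distributions. So all values agree once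
(AD-B) attains or approximates the value of (AP-W').

The gap between (AD-B') and (AP-W') is closed by Lagrange multipliers. A perspective constraint
`t f(v / t) ≤ r` with `t > 0` says that `(v, t, r)` lies in a convex cone, so that each of the two
programs becomes a linear program over a product of such cones. A Slater point lies in the core of
this product; separation in the span of the product and Farkas' lemma then yield multipliers, whose
coefficients are precisely a feasible point of the other program. For an affine `f` the constraint
need not be strict at the Slater point, and the cone is replaced by the graph of the perspective.

A point of (AD-B') with `λ > 0` is rescaled to a point of (AD-B). If `λ_i = 0`, then `υ_i` is a
direction of recession of `S`, which vanishes if `S` is bounded.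
-/

namespace UQ

open Filter Topology

/-! ### Lagrange multipliers for linear constraints -/

section Farkas

variable {𝕜 V κ : Type*} [Field 𝕜] [LinearOrder 𝕜] [IsStrictOrderedRing 𝕜]
  [AddCommGroup V] [Module 𝕜 V]

theorem mem_hull_insert_of_sub_smul_mem [DecidableEq κ] {s : Finset κ} {a : κ}
    {p : κ → Module.Dual 𝕜 V} {l : Module.Dual 𝕜 V} {c : κ → 𝕜} {r : 𝕜} (hc : ∀ k ∈ s, c k ≤ 0)
    (hr : 0 ≤ r) (h : l - r • p a ∈ PointedCone.hull 𝕜 ((fun k => p k - c k • p a) '' s)) :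
    l ∈ PointedCone.hull 𝕜 (p '' ↑(insert a s)) := by
  have hadd (q : Module.Dual 𝕜 V) (hq : q ∈ PointedCone.hull 𝕜 (p '' ↑(insert a s))) {t : 𝕜}
      (ht : 0 ≤ t) : q + t • p a ∈ PointedCone.hull 𝕜 (p '' ↑(insert a s)) :=
    add_mem hq (PointedCone.smul_mem _ ht (Submodule.subset_span ⟨a, by simp, rfl⟩))
  have hle : PointedCone.hull 𝕜 ((fun k => p k - c k • p a) '' s)
      ≤ PointedCone.hull 𝕜 (p '' ↑(insert a s)) := by
    refine Submodule.span_le.2 ?_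
    rintro _ ⟨k, hk, rfl⟩
    have heq : p k - c k • p a = p k + -c k • p a := by
      ext x
      simp [sub_eq_add_neg]
    change p k - c k • p a ∈ PointedCone.hull 𝕜 _
    rw [heq]
    exact hadd _ (Submodule.subset_span ⟨k, by simp [Finset.mem_coe.1 hk], rfl⟩)
      (neg_nonneg.2 (hc k hk))
  simpa using hadd _ (hle h) hr

/-- **Farkas' lemma** -/
theorem mem_hull_of_forall_nonpos (s : Finset κ) (p : κ → Module.Dual 𝕜 V) (l : Module.Dual 𝕜 V)
    (h : ∀ x, (∀ k ∈ s, p k x ≤ 0) → l x ≤ 0) : l ∈ PointedCone.hull 𝕜 (p '' s) := by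
  classical
  induction s using Finset.induction_on generalizing p l with
  | empty =>
    suffices l = 0 by simp [this]
    ext x
    have hneg : -l x ≤ 0 := by simpa using h (-x) (by simp)
    exact le_antisymm (h x (by simp)) (neg_nonpos.1 hneg)
  | insert a s ha ih =>
    by_cases hs : ∀ x, (∀ k ∈ s, p k x ≤ 0) → l x ≤ 0
    · refine Submodule.span_mono (Set.image_mono ?_) (ih p l hs)
      exact Finset.coe_subset.2 (Finset.subset_insert a s)
    push Not at hs
    obtain ⟨x₁, hx₁, hl₁⟩ := hs
    have hpa : 0 < p a x₁ := by
      by_contra hle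
      refine hl₁.not_ge (h x₁ fun k hk => ?_)
      rcases Finset.mem_insert.1 hk with rfl | hk
      exacts [not_lt.1 hle, hx₁ k hk]
    -- Projecting along `x₁` onto the kernel of `p a` eliminates the constraint `p a ≤ 0`.
    refine mem_hull_insert_of_sub_smul_mem (c := fun k => p k x₁ / p a x₁)
      (fun k hk => div_nonpos_of_nonpos_of_nonneg (hx₁ k hk) hpa.le) (div_pos hl₁ hpa).le
      (ih _ _ fun x hx => ?_)
    have hproj (q : Module.Dual 𝕜 V) :
        q (x - (p a x / p a x₁) • x₁) = (q - (q x₁ / p a x₁) • p a) x := by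
      simp only [map_sub, map_smul, LinearMap.sub_apply, LinearMap.smul_apply, smul_eq_mul]
      ring
    rw [← hproj l]
    refine h _ fun k hk => ?_
    rcases Finset.mem_insert.1 hk with rfl | hk
    · simp [hpa.ne']
    · exact (hproj (p k)).trans_le (hx k hk)

theorem exists_nonneg_eq_sum_of_forall_nonpos [Fintype κ] (p : κ → Module.Dual 𝕜 V)
    (l : Module.Dual 𝕜 V) (h : ∀ x, (∀ k, p k x ≤ 0) → l x ≤ 0) :
    ∃ η : κ → 𝕜, (∀ k, 0 ≤ η k) ∧ ∀ x, l x = ∑ k, η k * p k x := by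
  have hmem := mem_hull_of_forall_nonpos Finset.univ p l (by simpa using h)
  rw [Finset.coe_univ, Set.image_univ] at hmem
  obtain ⟨η, rfl⟩ := (Submodule.mem_span_range_iff_exists_fun _).1 hmem
  refine ⟨fun k => (η k : 𝕜), fun k => (η k).2, fun x => ?_⟩
  simp only [LinearMap.sum_apply]
  rfl

theorem apply_nonpos_of_forall_apply_le {p : κ → Module.Dual 𝕜 V} {a : κ → 𝕜} {l : Module.Dual 𝕜 V}
    {c : 𝕜} (h : ∀ x, (∀ k, p k x ≤ a k) → l x ≤ c) {x₀ : V} (hx₀ : ∀ k, p k x₀ ≤ a k) {y : V}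
    (hy : ∀ k, p k y ≤ 0) : l y ≤ 0 := by
  by_contra! hly
  have ht : 0 ≤ (c - l x₀ + 1) / l y := div_nonneg (by linarith [h x₀ hx₀]) hly.le
  have := h (x₀ + ((c - l x₀ + 1) / l y) • y) fun k => by
    simpa using add_le_add (hx₀ k) (mul_nonpos_of_nonneg_of_nonpos ht (hy k))
  simp only [map_add, map_smul, smul_eq_mul, div_mul_cancel₀ _ hly.ne'] at this
  linarith

theorem exists_nonneg_sub_le_sum_of_forall_le [Fintype κ] {p : κ → Module.Dual 𝕜 V} {a : κ → 𝕜}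
    {l : Module.Dual 𝕜 V} {c : 𝕜} (h : ∀ x, (∀ k, p k x ≤ a k) → l x ≤ c) {x₀ : V}
    (hx₀ : ∀ k, p k x₀ ≤ a k) :
    ∃ η : κ → 𝕜, (∀ k, 0 ≤ η k) ∧ ∀ x, l x - c ≤ ∑ k, η k * (p k x - a k) := by
  let fst := LinearMap.fst 𝕜 V 𝕜
  let snd := LinearMap.snd 𝕜 V 𝕜
  obtain ⟨η, hη₀, hη⟩ := exists_nonneg_eq_sum_of_forall_nonpos
    (fun o : Option κ => o.elim (-snd) fun k => p k ∘ₗ fst - a k • snd) (l ∘ₗ fst - c • snd) (by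
      rintro ⟨x, s⟩ hx
      have hs : 0 ≤ s := neg_nonpos.1 (hx none)
      have hk (k : κ) : p k x - a k * s ≤ 0 := hx (some k)
      change l x - c * s ≤ 0
      rcases hs.eq_or_lt with rfl | hs
      · simpa using apply_nonpos_of_forall_apply_le h hx₀ (y := x) (by simpa using hk)
      · have := h (s⁻¹ • x) fun k => by
          simpa [inv_mul_le_iff₀ hs, mul_comm] using hk k
        simpa [inv_mul_le_iff₀ hs, mul_comm] using this)
  refine ⟨fun k => η (some k), fun k => hη₀ _, fun x => ?_⟩
  have hx : l x - c * 1 = ∑ o : Option κ, _ := hη (x, 1)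
  simp only [Fintype.sum_option] at hx
  have h₁ : η none * (-snd) (x, 1) ≤ 0 := by simpa [snd] using hη₀ none
  simp only [mul_one, Option.elim, fst, snd, LinearMap.sub_apply, LinearMap.comp_apply,
    LinearMap.fst_apply, LinearMap.smul_apply, LinearMap.snd_apply, smul_eq_mul] at hx h₁
  linarith

end Farkas

section Multipliers

/-- `x` lies in `C` and every segment from a point of `C` to `x` can be prolonged within `C`: an
algebraic form of membership in the relative interior of a convex set. -/
def IsCorePoint {V : Type*} [AddCommGroup V] [Module ℝ V] (C : Set V) (x : V) : Prop :=
  x ∈ C ∧ ∀ y ∈ C, ∀ᶠ ε : ℝ in 𝓝[>] 0, x - ε • (y - x) ∈ C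

theorem IsCorePoint.translate {V : Type*} [AddCommGroup V] [Module ℝ V] {C : Set V} {x₀ : V}
    (h : IsCorePoint C x₀) : IsCorePoint ((x₀ + ·) ⁻¹' C) 0 :=
  ⟨by simpa using h.1, fun y hy => by simpa [sub_eq_add_neg] using h.2 _ hy⟩

theorem isCorePoint_of_mem_intrinsicInterior {V : Type*} [AddCommGroup V] [Module ℝ V]
    [TopologicalSpace V] [ContinuousAdd V] [ContinuousSMul ℝ V] {C : Set V} {x : V}
    (hx : x ∈ intrinsicInterior ℝ C) : IsCorePoint C x := by
  refine ⟨intrinsicInterior_subset hx, fun y hy => ?_⟩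
  obtain ⟨⟨x, hxC⟩, hint, rfl⟩ := mem_intrinsicInterior.1 hx
  let γ (ε : ℝ) : affineSpan ℝ C := ⟨AffineMap.lineMap x y (-ε),
    AffineMap.lineMap_mem _ hxC (subset_affineSpan ℝ C hy)⟩
  have hγ : Continuous γ := by
    simp only [γ, AffineMap.lineMap_apply]
    fun_prop
  have hmem : ∀ᶠ ε in 𝓝 (0 : ℝ), (γ ε : V) ∈ C :=
    (hγ.tendsto' 0 ⟨x, hxC⟩ (by simp [γ])).eventually (mem_interior_iff_mem_nhds.1 hint)
  refine (hmem.filter_mono nhdsWithin_le_nhds).mono fun ε hε => ?_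
  convert hε using 1
  simp only [γ, AffineMap.lineMap_apply, vsub_eq_sub, vadd_eq_add, neg_smul]
  abel

theorem IsCorePoint.mem_interior {V : Type*} [AddCommGroup V] [Module ℝ V] [TopologicalSpace V]
    [IsTopologicalAddGroup V] [ContinuousConstSMul ℝ V] {C : Set V} {x : V} (hx : IsCorePoint C x)
    (hC : Convex ℝ C) (hne : (interior C).Nonempty) : x ∈ interior C := by
  obtain ⟨y, hy⟩ := hne
  obtain ⟨ε, hmem, hε : 0 < ε⟩ := ((hx.2 y (interior_subset hy)).and self_mem_nhdsWithin).exists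
  refine hC.openSegment_interior_self_subset_interior hy hmem
    ⟨ε / (1 + ε), 1 / (1 + ε), by positivity, by positivity, by field_simp; ring, ?_⟩
  match_scalars <;> field_simp <;> ring

theorem isCorePoint_pi {ι : Type*} [Finite ι] {E : ι → Type*} [∀ i, AddCommGroup (E i)]
    [∀ i, Module ℝ (E i)] {C : ∀ i, Set (E i)} {x : ∀ i, E i}
    (hx : ∀ i, IsCorePoint (C i) (x i)) : IsCorePoint (Set.univ.pi C) x :=
  ⟨fun i _ => (hx i).1, fun y hy =>
    (eventually_all.2 fun i => (hx i).2 (y i) (hy i trivial)).mono fun _ h i _ => h i⟩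

theorem exists_affine_separation {V : Type*} [AddCommGroup V] [Module ℝ V] [TopologicalSpace V]
    [IsTopologicalAddGroup V] [ContinuousSMul ℝ V] {C T : Set V} (hC : Convex ℝ C) (hCo : IsOpen C)
    (hT : Convex ℝ T) {x₀ : V} (hx₀C : x₀ ∈ C) (hx₀T : x₀ ∈ T) {l : StrongDual ℝ V} {c : ℝ}
    (h : ∀ x ∈ C, x ∈ T → l x ≤ c) :
    ∃ (g : StrongDual ℝ V) (u : ℝ), (∀ x ∈ C, l x - c ≤ g x - u) ∧ ∀ x ∈ T, g x ≤ u := by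
  let s : Set (V × ℝ) := {q | q.1 ∈ C ∧ q.2 < l q.1 - c}
  have hs : Convex ℝ s :=
    (((l : V →ₗ[ℝ] ℝ).concaveOn hC).sub (convexOn_const c hC)).convex_strict_hypograph
  have hso : IsOpen s := (hCo.preimage continuous_fst).inter
    (isOpen_lt continuous_snd (by fun_prop))
  have hdisj : Disjoint s (T ×ˢ Set.Ici 0) :=
    Set.disjoint_left.2 fun q hq hqT => by linarith [h q.1 hq.1 hqT.1, hq.2, Set.mem_Ici.1 hqT.2]
  obtain ⟨f, u, hfs, hft⟩ := geometric_hahn_banach_open hs hso (hT.prod (convex_Ici 0)) hdisj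
  set b : ℝ := f (0, 1)
  let φ : StrongDual ℝ V := f.comp (.inl ℝ V ℝ)
  have hf (x : V) (r : ℝ) : f (x, r) = φ x + b * r := by
    rw [show ((x, r) : V × ℝ) = (x, 0) + r • (0, 1) by simp, map_add, map_smul, smul_eq_mul,
      mul_comm]
    rfl
  have hφT (x : V) (hx : x ∈ T) : u ≤ φ x := by
    simpa [hf] using hft (x, 0) ⟨hx, Set.mem_Ici.2 le_rfl⟩
  have hb : 0 < b := by
    have hlt := hfs (x₀, l x₀ - c - 1) ⟨hx₀C, by simp⟩
    rw [hf] at hlt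
    have hneg : b * (l x₀ - c - 1) < 0 := by linarith [hφT x₀ hx₀T]
    exact pos_of_mul_neg_left hneg (by linarith [h x₀ hx₀C hx₀T])
  refine ⟨-(b⁻¹ • φ), -(b⁻¹ * u), fun x hx => le_of_forall_lt fun r hr => ?_, fun x hx => ?_⟩
  · have := hfs (x, r) ⟨hx, hr⟩
    rw [hf] at this
    calc r < b⁻¹ * (u - φ x) := by rw [lt_inv_mul_iff₀ hb]; linarith
      _ = (-(b⁻¹ • φ)) x - -(b⁻¹ * u) := by
        simp only [neg_apply, smul_apply, smul_eq_mul]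
        ring
  · simpa [hb] using hφT x hx

section MultiplierTheorem

variable {V κ : Type*} [NormedAddCommGroup V] [NormedSpace ℝ V] [FiniteDimensional ℝ V] [Fintype κ]
  {C : Set V} {p : κ → Module.Dual ℝ V} {a : κ → ℝ} {l : Module.Dual ℝ V} {c : ℝ} {x₀ : V}

theorem exists_multipliers_of_mem_interior (hC : Convex ℝ C) (hx₀C : x₀ ∈ interior C)
    (hx₀ : ∀ k, p k x₀ ≤ a k) (h : ∀ x ∈ C, (∀ k, p k x ≤ a k) → l x ≤ c) :
    ∃ η : κ → ℝ, (∀ k, 0 ≤ η k) ∧ ∀ x ∈ C, l x - c ≤ ∑ k, η k * (p k x - a k) := by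
  have hT : Convex ℝ {x | ∀ k, p k x ≤ a k} := by
    simp only [Set.ofPred_forall]
    exact convex_iInter fun k => convex_halfSpace_le (p k).isLinear (a k)
  obtain ⟨g, u, hg, hgT⟩ := exists_affine_separation hC.interior isOpen_interior hT hx₀C hx₀
    (l := LinearMap.toContinuousLinearMap l) fun x hx hk => h x (interior_subset hx) hk
  obtain ⟨η, hη₀, hη⟩ := exists_nonneg_sub_le_sum_of_forall_le (l := (g : V →ₗ[ℝ] ℝ)) hgT hx₀
  have hint : interior C ⊆ {x | l x - c ≤ ∑ k, η k * (p k x - a k)} := fun x hx =>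
    (hg x hx).trans (hη x)
  refine ⟨η, hη₀, fun x hx => closure_minimal hint ?_ ?_⟩
  · have hl := l.continuous_of_finiteDimensional
    have hp (k : κ) := (p k).continuous_of_finiteDimensional
    exact isClosed_le (by fun_prop) (by fun_prop)
  · rw [hC.closure_interior_eq_closure_of_nonempty_interior ⟨x₀, hx₀C⟩]
    exact subset_closure hx

theorem interior_preimage_subtype_span_nonempty (hC : Convex ℝ C) (h₀ : (0 : V) ∈ C) :
    (interior ((↑) ⁻¹' C : Set (Submodule.span ℝ C))).Nonempty := by
  set C' : Set (Submodule.span ℝ C) := (↑) ⁻¹' C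
  have hC' : Convex ℝ C' := hC.linear_preimage (Submodule.span ℝ C).subtype
  have h₀' : 0 ∈ C' := h₀
  rw [hC'.interior_nonempty_iff_affineSpan_eq_top,
    AffineSubspace.affineSpan_eq_top_iff_vectorSpan_eq_top_of_nonempty _ _ _ ⟨0, h₀'⟩,
    vectorSpan_eq_span_vsub_set_right ℝ h₀']
  simp [C']

/-- The core point replaces Slater's condition: linear constraints need not hold strictly at it. -/
theorem exists_multipliers (hC : Convex ℝ C) (hcore : IsCorePoint C x₀) (hx₀ : ∀ k, p k x₀ ≤ a k)
    (h : ∀ x ∈ C, (∀ k, p k x ≤ a k) → l x ≤ c) :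
    ∃ η : κ → ℝ, (∀ k, 0 ≤ η k) ∧ ∀ x ∈ C, l x - c ≤ ∑ k, η k * (p k x - a k) := by
  set C' : Set V := (x₀ + ·) ⁻¹' C
  have hC' : Convex ℝ C' := hC.translate_preimage_right x₀
  let W := Submodule.span ℝ C'
  have hcore' : IsCorePoint ((↑) ⁻¹' C' : Set W) 0 :=
    ⟨hcore.translate.1, fun w hw => hcore.translate.2 w hw⟩
  have hint : (0 : W) ∈ interior ((↑) ⁻¹' C') :=
    hcore'.mem_interior (hC'.linear_preimage W.subtype)
      (interior_preimage_subtype_span_nonempty hC' hcore.translate.1)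
  obtain ⟨η, hη₀, hη⟩ := exists_multipliers_of_mem_interior (p := fun k => p k ∘ₗ W.subtype)
    (a := fun k => a k - p k x₀) (l := l ∘ₗ W.subtype) (c := c - l x₀)
    (hC'.linear_preimage W.subtype) hint (by simpa using hx₀) fun w hw hk => by
      have := h (x₀ + w) hw fun k => by
        rw [map_add, ← le_sub_iff_add_le']
        exact hk k
      rw [map_add] at this
      exact le_sub_iff_add_le'.2 this
  refine ⟨η, hη₀, fun x hx => ?_⟩
  have hxC' : x - x₀ ∈ C' := by simpa [C'] using hx
  simpa using hη ⟨x - x₀, Submodule.subset_span hxC'⟩ hxC'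

theorem exists_multipliers_of_eq {F : Type*} [AddCommGroup F] [Module ℝ F]
    [FiniteDimensional ℝ F] (hC : Convex ℝ C) (hcore : IsCorePoint C x₀)
    (hx₀ : ∀ k, p k x₀ ≤ a k) {Q : V →ₗ[ℝ] F} {b : F} (hQ : Q x₀ = b)
    (h : ∀ x ∈ C, (∀ k, p k x ≤ a k) → Q x = b → l x ≤ c) :
    ∃ (η : κ → ℝ) (θ : Module.Dual ℝ F), (∀ k, 0 ≤ η k) ∧
      ∀ x ∈ C, l x - c ≤ ∑ k, η k * (p k x - a k) + θ (Q x - b) := by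
  let B := Module.finBasis ℝ F
  obtain ⟨η, hη₀, hη⟩ := exists_multipliers (l := l) (c := c)
    (p := Sum.elim p (Sum.elim (fun m => B.coord m ∘ₗ Q) fun m => -(B.coord m ∘ₗ Q)))
    (a := Sum.elim a (Sum.elim (fun m => B.coord m b) fun m => -B.coord m b)) hC hcore
    (by rintro (k | m | m) <;> simp [hx₀, hQ]) fun x hx hk =>
      h x hx (fun k => hk (.inl k)) <| B.ext_elem fun m =>
        le_antisymm (hk (.inr (.inl m))) (neg_le_neg_iff.1 (hk (.inr (.inr m))))
  refine ⟨fun k => η (.inl k), ∑ m, (η (.inr (.inl m)) - η (.inr (.inr m))) • B.coord m,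
    fun k => hη₀ _, fun x hx => (hη x hx).trans_eq ?_⟩
  simp only [Fintype.sum_sum_type, Sum.elim_inl, Sum.elim_inr, LinearMap.sum_apply,
    LinearMap.smul_apply, LinearMap.neg_apply, LinearMap.comp_apply, map_sub, smul_eq_mul,
    ← Finset.sum_add_distrib, ← Finset.sum_sub_distrib]
  congr! 2
  ring

end MultiplierTheorem

end Multipliers

/-! ### Convex functions, conjugates and perspectives -/

section ERealSums

variable {ι : Type*}

theorem ereal_coe_sum (s : Finset ι) (ρ : ι → ℝ) :
    ((∑ i ∈ s, ρ i : ℝ) : EReal) = ∑ i ∈ s, (ρ i : EReal) :=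
  map_sum (⟨⟨Real.toEReal, EReal.coe_zero⟩, EReal.coe_add⟩ : ℝ →+ EReal) ρ s

theorem bot_lt_ereal_sum {s : Finset ι} {e : ι → EReal} (he : ∀ i ∈ s, ⊥ < e i) :
    ⊥ < ∑ i ∈ s, e i :=
  Finset.sum_induction e (⊥ < ·) (fun _ _ ha hb => EReal.bot_lt_add_iff.2 ⟨ha, hb⟩)
    EReal.bot_lt_zero he

theorem exists_real_of_ereal_sum_le {s : Finset ι} {e : ι → EReal} (he : ∀ i ∈ s, ⊥ < e i) {a : ℝ}
    (h : ∑ i ∈ s, e i ≤ a) : ∃ ρ : ι → ℝ, (∀ i ∈ s, e i = ρ i) ∧ ∑ i ∈ s, ρ i ≤ a := by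
  classical
  have hreal : ∀ i ∈ s, e i = (e i).toReal := fun i hi => by
    refine (EReal.coe_toReal (fun htop => ?_) (he i hi).ne').symm
    have hrest := bot_lt_ereal_sum fun k (hk : k ∈ s.erase i) => he k (Finset.mem_of_mem_erase hk)
    rw [← Finset.add_sum_erase s e hi, htop, EReal.top_add_of_ne_bot hrest.ne'] at h
    exact EReal.coe_ne_top a (top_le_iff.1 h)
  refine ⟨fun i => (e i).toReal, hreal, ?_⟩
  rwa [Finset.sum_congr rfl hreal, ← ereal_coe_sum, EReal.coe_le_coe_iff] at h

theorem ereal_sub_coe_lt_top_iff {a : EReal} {r : ℝ} : a - r < ⊤ ↔ a < ⊤ := by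
  rw [EReal.sub_lt_iff (.inl (EReal.coe_ne_bot r)) (.inl (EReal.coe_ne_top r)), EReal.top_add_coe]

theorem ereal_coe_pos_mul_lt_top_iff {a : EReal} {r : ℝ} (hr : 0 < r) : r * a < ⊤ ↔ a < ⊤ := by
  rw [mul_comm, ← EReal.lt_div_iff (EReal.coe_pos.2 hr) (EReal.coe_ne_top r),
    EReal.top_div_of_pos_ne_top (EReal.coe_pos.2 hr) (EReal.coe_ne_top r)]

end ERealSums

section ConvexFunctions

variable {d : ℕ} {f : EuclideanSpace ℝ (Fin d) → EReal}

theorem IsProper.exists_real {X : Type*} {f : X → EReal} (hf : IsProper f) {x : X}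
    (hx : x ∈ dom f) : ∃ r : ℝ, f x = r :=
  ⟨(f x).toReal, (EReal.coe_toReal (ne_of_lt hx) (hf.1 x).ne').symm⟩

theorem IsConvexFun.le_combo {X : Type*} [AddCommGroup X] [Module ℝ X] {f : X → EReal}
    (hf : IsConvexFun f) {x y : X} {r s a b : ℝ} (hx : f x ≤ r) (hy : f y ≤ s) (ha : 0 ≤ a)
    (hb : 0 ≤ b) (hab : a + b = 1) : f (a • x + b • y) ≤ ((a * r + b * s : ℝ) : EReal) :=
  hf (x := (x, r)) hx (y := (y, s)) hy ha hb hab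

theorem IsClosedFun.isClosed_epigraph {X : Type*} [TopologicalSpace X] {f : X → EReal}
    (hf : IsClosedFun f) : IsClosed (epigraph f) :=
  (lowerSemicontinuous_iff_isClosed_epigraph.1 hf.1).preimage
    (continuous_fst.prodMk (continuous_coe_real_ereal.comp continuous_snd))

theorem conj_le_coe_iff {w : EuclideanSpace ℝ (Fin d)} {r : ℝ} :
    conj f w ≤ r ↔ ∀ x, ((inner ℝ x w - r : ℝ) : EReal) ≤ f x := by
  rw [conj, iSup_le_iff]
  refine forall_congr' fun x => ?_
  induction f x using EReal.rec with
  | bot => simp [-EReal.coe_sub]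
  | top => simp
  | coe t => norm_cast; exact sub_le_comm

theorem conj_le_coe_iff_of_bot_lt (hf : ∀ x, ⊥ < f x) {w : EuclideanSpace ℝ (Fin d)} {r : ℝ} :
    conj f w ≤ r ↔ ∀ x (s : ℝ), f x = s → inner ℝ x w - r ≤ s := by
  refine conj_le_coe_iff.trans (forall_congr' fun x => ?_)
  induction hx : f x using EReal.rec with
  | bot => exact absurd hx (hf x).ne'
  | top => simp
  | coe s => norm_cast; exact ⟨fun h t ht => ht ▸ h, fun h => h s rfl⟩

theorem inner_le_of_conj_le {w x : EuclideanSpace ℝ (Fin d)} {r s : ℝ} (hw : conj f w ≤ r)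
    (hx : f x ≤ s) : inner ℝ x w ≤ r + s := by
  have hle := (conj_le_coe_iff.1 hw x).trans hx
  rw [EReal.coe_le_coe_iff] at hle
  linarith

theorem exists_eq_inner_add_mul (F : Module.Dual ℝ (EuclideanSpace ℝ (Fin d) × ℝ)) :
    ∃ (y : EuclideanSpace ℝ (Fin d)) (b : ℝ), ∀ x s, F (x, s) = inner ℝ x y + b * s := by
  refine ⟨(InnerProductSpace.toDual ℝ _).symm
    (LinearMap.toContinuousLinearMap (F ∘ₗ LinearMap.inl ℝ _ ℝ)), F (0, 1), fun x s => ?_⟩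
  rw [real_inner_comm, InnerProductSpace.toDual_symm_apply, mul_comm, ← smul_eq_mul, ← map_smul]
  simp only [LinearMap.coe_toContinuousLinearMap', LinearMap.comp_apply, LinearMap.inl_apply]
  rw [← map_add, Prod.smul_mk, smul_zero, smul_eq_mul, mul_one, Prod.mk_add_mk, add_zero, zero_add]

theorem IsPCC.exists_separation (hf : IsPCC f) {x₀ : EuclideanSpace ℝ (Fin d)} {r : ℝ}
    (h : (r : EReal) < f x₀) : ∃ (w : EuclideanSpace ℝ (Fin d)) (b u : ℝ), b ≤ 0 ∧
      (∀ x (s : ℝ), f x ≤ s → inner ℝ x w + b * s < u) ∧ u < inner ℝ x₀ w + b * r := by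
  obtain ⟨F, u, hF, hu⟩ := geometric_hahn_banach_closed_point (x := (x₀, r)) hf.convex
    hf.closed.isClosed_epigraph (not_le.2 h)
  obtain ⟨w, b, hFwb⟩ := exists_eq_inner_add_mul F.toLinearMap
  have hlt : ∀ x (s : ℝ), f x ≤ s → inner ℝ x w + b * s < u := fun x s hx =>
    (hFwb x s).symm.trans_lt (hF (x, s) hx)
  refine ⟨w, b, u, not_lt.1 fun hb => ?_, hlt, hu.trans_eq (hFwb x₀ r)⟩
  obtain ⟨x₁, hx₁⟩ := hf.proper.2
  obtain ⟨s, hs⟩ := hf.proper.exists_real hx₁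
  have hle : inner ℝ x₁ w + b * (max s ((u - inner ℝ x₁ w) / b)) < u :=
    hlt x₁ _ (hs.trans_le (EReal.coe_le_coe_iff.2 (le_max_left _ _)))
  have := (div_le_iff₀' hb).1 (le_max_right s ((u - inner ℝ x₁ w) / b))
  linarith

theorem exists_conj_le_of_separation {x₀ w : EuclideanSpace ℝ (Fin d)} {b u r : ℝ} (hb : b < 0)
    (hbot : ∀ x, ⊥ < f x) (h : ∀ x (s : ℝ), f x ≤ s → inner ℝ x w + b * s < u)
    (h₀ : u < inner ℝ x₀ w + b * r) :
    ∃ (w' : EuclideanSpace ℝ (Fin d)) (c : ℝ), conj f w' ≤ c ∧ r < inner ℝ x₀ w' - c := by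
  have hb' : 0 < -b := neg_pos.2 hb
  refine ⟨(-b)⁻¹ • w, (-b)⁻¹ * u, (conj_le_coe_iff_of_bot_lt hbot).2 fun x s hs => ?_, ?_⟩
  · rw [inner_smul_right, ← mul_sub, inv_mul_le_iff₀ hb']
    linarith [h x s hs.le]
  · rw [inner_smul_right, ← mul_sub, lt_inv_mul_iff₀ hb']
    linarith

theorem IsPCC.exists_conj_le (hf : IsPCC f) :
    ∃ (w : EuclideanSpace ℝ (Fin d)) (c : ℝ), conj f w ≤ c := by
  obtain ⟨x₁, hx₁⟩ := hf.proper.2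
  obtain ⟨s, hs⟩ := hf.proper.exists_real hx₁
  obtain ⟨w, b, u, hb, h, h₀⟩ := hf.exists_separation (x₀ := x₁) (r := s - 1) <| by
    rw [hs, EReal.coe_lt_coe_iff]
    linarith
  have hb' : b ≠ 0 := fun hb0 => by
    have := h x₁ s hs.le
    simp only [hb0, zero_mul] at this h₀
    linarith
  obtain ⟨w', c, hw', -⟩ := exists_conj_le_of_separation (hb.lt_of_ne hb') hf.proper.1 h h₀
  exact ⟨w', c, hw'⟩

theorem IsPCC.exists_conj_le_of_lt (hf : IsPCC f) {x₀ : EuclideanSpace ℝ (Fin d)} {r : ℝ}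
    (hr : (r : EReal) < f x₀) :
    ∃ (w : EuclideanSpace ℝ (Fin d)) (c : ℝ), conj f w ≤ c ∧ r < inner ℝ x₀ w - c := by
  obtain ⟨w, b, u, hb, h, h₀⟩ := hf.exists_separation hr
  rcases hb.eq_or_lt with rfl | hb
  -- A vertical hyperplane is tilted by adding a large multiple of it to an affine minorant.
  · obtain ⟨w₁, c₁, h₁⟩ := hf.exists_conj_le
    simp only [zero_mul, add_zero] at h h₀
    obtain ⟨n, hn⟩ := exists_nat_gt ((r - inner ℝ x₀ w₁ + c₁) / (inner ℝ x₀ w - u))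
    rw [div_lt_iff₀ (sub_pos.2 h₀)] at hn
    refine ⟨w₁ + (n : ℝ) • w, c₁ + n * u,
      (conj_le_coe_iff_of_bot_lt hf.proper.1).2 fun x s hs => ?_, ?_⟩
    · have hx₁ := inner_le_of_conj_le h₁ hs.le
      have hx := mul_le_mul_of_nonneg_left (h x s hs.le).le (Nat.cast_nonneg n)
      rw [inner_add_right, inner_smul_right]
      linarith
    · rw [inner_add_right, inner_smul_right]
      linarith
  · exact exists_conj_le_of_separation hb hf.proper.1 h h₀

theorem conj_conj_le {x : EuclideanSpace ℝ (Fin d)} {r : ℝ} (h : f x ≤ r) :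
    conj (conj f) x ≤ r := by
  rw [conj_le_coe_iff]
  intro w
  rw [real_inner_comm, EReal.coe_sub]
  exact (EReal.sub_le_sub le_rfl h).trans (le_iSup (fun x => ((inner ℝ x w : ℝ) : EReal) - f x) x)

/-- The nontrivial half of the **Fenchel–Moreau theorem**. -/
theorem IsPCC.le_of_conj_conj_le (hf : IsPCC f) {x : EuclideanSpace ℝ (Fin d)} {r : ℝ}
    (h : conj (conj f) x ≤ r) : f x ≤ r := by
  by_contra! hlt
  obtain ⟨w, c, hw, hr⟩ := hf.exists_conj_le_of_lt hlt
  have := inner_le_of_conj_le h hw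
  rw [real_inner_comm] at this
  linarith

theorem bot_lt_conj (hf : (dom f).Nonempty) (w : EuclideanSpace ℝ (Fin d)) : ⊥ < conj f w := by
  obtain ⟨x, hx⟩ := hf
  refine lt_of_lt_of_le ?_ (le_iSup (fun x => ((inner ℝ x w : ℝ) : EReal) - f x) x)
  rw [sub_eq_add_neg, EReal.bot_lt_add_iff]
  exact ⟨EReal.bot_lt_coe _, EReal.neg_lt_neg_iff.2 hx⟩

theorem IsPCC.isProper_conj (hf : IsPCC f) : IsProper (conj f) :=
  ⟨bot_lt_conj hf.proper.2,
    let ⟨w, c, h⟩ := hf.exists_conj_le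
    ⟨w, h.trans_lt (EReal.coe_lt_top c)⟩⟩

theorem IsPCC.dom_conj_conj (hf : IsPCC f) : dom (conj (conj f)) = dom f := by
  ext x
  refine ⟨fun hx => ?_, fun hx => ?_⟩
  · have hbot := (bot_lt_conj hf.isProper_conj.2 x).ne'
    exact (hf.le_of_conj_conj_le (EReal.coe_toReal (ne_of_lt hx) hbot).ge).trans_lt
      (EReal.coe_lt_top _)
  · obtain ⟨r, hr⟩ := hf.proper.exists_real hx
    exact (conj_conj_le hr.le).trans_lt (EReal.coe_lt_top r)

theorem isConvexFun_conj : IsConvexFun (conj f) := by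
  rintro ⟨x, r⟩ hx ⟨y, s⟩ hy a b ha hb hab
  refine conj_le_coe_iff.2 fun z => ?_
  have hxz := conj_le_coe_iff.1 hx z
  have hyz := conj_le_coe_iff.1 hy z
  induction hfz : f z using EReal.rec with
  | bot => exact absurd (hfz ▸ hxz) (not_le.2 (EReal.bot_lt_coe _))
  | top => exact le_top
  | coe t =>
    rw [hfz, EReal.coe_le_coe_iff] at hxz hyz
    rw [EReal.coe_le_coe_iff]
    simp only [Prod.fst_add, Prod.smul_fst, Prod.snd_add, Prod.smul_snd, inner_add_right,
      inner_smul_right, smul_eq_mul] at hxz hyz ⊢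
    calc a * inner ℝ z x + b * inner ℝ z y - (a * r + b * s)
        = a * (inner ℝ z x - r) + b * (inner ℝ z y - s) := by ring
      _ ≤ a * t + b * t := by gcongr
      _ = t := by rw [← add_mul, hab, one_mul]

end ConvexFunctions

section Perspectives

variable {d : ℕ} {f : EuclideanSpace ℝ (Fin d) → EReal}

theorem persp_le_iff_of_pos {x : EuclideanSpace ℝ (Fin d)} {t r : ℝ} (ht : 0 < t) :
    persp f x t ≤ r ↔ f (t⁻¹ • x) ≤ ((r / t : ℝ) : EReal) := by
  rw [persp, if_pos ht, EReal.coe_div, mul_comm,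
    EReal.le_div_iff_mul_le (EReal.coe_pos.2 ht) (EReal.coe_ne_top t)]

theorem persp_zero_le_iff {x : EuclideanSpace ℝ (Fin d)} {r : ℝ} :
    persp f x 0 ≤ r ↔ ∀ w ∈ dom (conj f), inner ℝ w x ≤ r := by
  rw [persp, if_neg (lt_irrefl _), if_pos rfl, supportFun]
  simp only [iSup_le_iff, EReal.coe_le_coe_iff]

theorem persp_one (x : EuclideanSpace ℝ (Fin d)) : persp f x 1 = f x := by
  rw [persp, if_pos one_pos, inv_one, one_smul, EReal.coe_one, one_mul]

theorem persp_smul {t : ℝ} (ht : 0 < t) (x : EuclideanSpace ℝ (Fin d)) :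
    persp f (t • x) t = t * f x := by
  rw [persp, if_pos ht, inv_smul_smul₀ ht.ne']

theorem nonneg_of_persp_lt_top {x : EuclideanSpace ℝ (Fin d)} {t : ℝ} (h : persp f x t < ⊤) :
    0 ≤ t := by
  by_contra! ht
  rw [persp, if_neg ht.le.not_gt, if_neg ht.ne] at h
  exact lt_irrefl _ h

theorem bot_lt_persp (hf : ∀ x, ⊥ < f x) (hd : (dom (conj f)).Nonempty)
    (x : EuclideanSpace ℝ (Fin d)) (t : ℝ) : ⊥ < persp f x t := by
  unfold persp
  split_ifs with ht ht
  · induction hx : f (t⁻¹ • x) using EReal.rec with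
    | bot => exact absurd hx (hf _).ne'
    | top => rw [EReal.coe_mul_top_of_pos ht]; exact bot_lt_top
    | coe s => exact EReal.bot_lt_coe (t * s)
  · obtain ⟨w, hw⟩ := hd
    exact (EReal.bot_lt_coe _).trans_le (le_iSup₂ (f := fun x₁ (_ : x₁ ∈ dom (conj f)) =>
      ((inner ℝ x₁ x : ℝ) : EReal)) w hw)
  · exact bot_lt_top

theorem IsPCC.bot_lt_persp_conj (hf : IsPCC f) (x : EuclideanSpace ℝ (Fin d)) (t : ℝ) :
    ⊥ < persp (conj f) x t :=
  bot_lt_persp hf.isProper_conj.1 (hf.dom_conj_conj ▸ hf.proper.2) x t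

theorem IsPCC.le_add_smul (hf : IsPCC f) {z v : EuclideanSpace ℝ (Fin d)} {r s t : ℝ}
    (hz : f z ≤ r) (hv : persp f v 0 ≤ s) (ht : 0 ≤ t) :
    f (z + t • v) ≤ ((r + t * s : ℝ) : EReal) := by
  refine hf.le_of_conj_conj_le ((conj_le_coe_iff_of_bot_lt hf.isProper_conj.1).2 fun w c hw => ?_)
  have hzw := inner_le_of_conj_le hw.le hz
  have hvw := persp_zero_le_iff.1 hv w (hw.trans_lt (EReal.coe_lt_top c))
  rw [inner_add_right, inner_smul_right, real_inner_comm]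
  linarith [mul_le_mul_of_nonneg_left hvw ht]

theorem IsPCC.inner_nonpos_of_persp_zero_le (hf : IsPCC f) {v y : EuclideanSpace ℝ (Fin d)}
    {r s : ℝ} (hv : persp f v 0 ≤ r) (hy : persp (conj f) y 0 ≤ s) : inner ℝ v y ≤ 0 := by
  obtain ⟨z, hz⟩ := hf.proper.2
  obtain ⟨c, hc⟩ := hf.proper.exists_real hz
  by_contra! hpos
  obtain ⟨n, hn⟩ := exists_nat_gt ((s - inner ℝ z y) / inner ℝ v y)
  rw [div_lt_iff₀ hpos] at hn
  have hray := conj_conj_le (hf.le_add_smul hc.le hv n.cast_nonneg)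
  have hle := persp_zero_le_iff.1 hy _ (hray.trans_lt (EReal.coe_lt_top _))
  rw [inner_add_left, real_inner_smul_left] at hle
  linarith

theorem IsPCC.inner_le_of_persp_le (hf : IsPCC f) {v y : EuclideanSpace ℝ (Fin d)}
    {t s a b : ℝ} (hv : persp f v t ≤ a) (hy : persp (conj f) y s ≤ b) :
    inner ℝ v y ≤ s * a + t * b := by
  rcases (nonneg_of_persp_lt_top (hv.trans_lt (EReal.coe_lt_top a))).eq_or_lt with rfl | ht <;>
    rcases (nonneg_of_persp_lt_top (hy.trans_lt (EReal.coe_lt_top b))).eq_or_lt with rfl | hs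
  · simpa only [zero_mul, add_zero] using hf.inner_nonpos_of_persp_zero_le hv hy
  · rw [persp_le_iff_of_pos hs] at hy
    have hle := persp_zero_le_iff.1 hv _ (hy.trans_lt (EReal.coe_lt_top _))
    rw [real_inner_smul_left, inv_mul_le_iff₀ hs, real_inner_comm] at hle
    linarith
  · rw [persp_le_iff_of_pos ht] at hv
    have hle := persp_zero_le_iff.1 hy _ ((conj_conj_le hv).trans_lt (EReal.coe_lt_top _))
    rw [real_inner_smul_left, inv_mul_le_iff₀ ht] at hle
    linarith
  · rw [persp_le_iff_of_pos ht] at hv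
    rw [persp_le_iff_of_pos hs] at hy
    have hle := inner_le_of_conj_le hy hv
    rw [real_inner_smul_left, real_inner_smul_right, inv_mul_le_iff₀ ht, inv_mul_le_iff₀ hs] at hle
    refine hle.trans_eq ?_
    field_simp
    ring

theorem IsPCC.persp_conj_le (hf : IsPCC f) {y : EuclideanSpace ℝ (Fin d)} {s b : ℝ} (hs : 0 ≤ s)
    (h : ∀ z (r : ℝ), f z = r → inner ℝ z y - s * r ≤ b) : persp (conj f) y s ≤ b := by
  rcases hs.eq_or_lt with rfl | hs
  · refine persp_zero_le_iff.2 fun z hz => ?_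
    rw [hf.dom_conj_conj] at hz
    obtain ⟨r, hr⟩ := hf.proper.exists_real hz
    simpa only [zero_mul, sub_zero] using h z r hr
  · refine (persp_le_iff_of_pos hs).2 ((conj_le_coe_iff_of_bot_lt hf.proper.1).2 fun z r hz => ?_)
    rw [inner_smul_right, ← div_eq_inv_mul, ← sub_div, div_le_iff₀ hs]
    linarith [h z r hz]

theorem IsPCC.persp_le_of_conj (hf : IsPCC f) {v : EuclideanSpace ℝ (Fin d)} {t b : ℝ} (ht : 0 ≤ t)
    (h : ∀ w (c : ℝ), conj f w = c → inner ℝ w v - t * c ≤ b) : persp f v t ≤ b := by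
  rcases ht.eq_or_lt with rfl | ht
  · refine persp_zero_le_iff.2 fun w hw => ?_
    obtain ⟨c, hc⟩ := hf.isProper_conj.exists_real hw
    simpa only [zero_mul, sub_zero] using h w c hc
  · refine (persp_le_iff_of_pos ht).2 (hf.le_of_conj_conj_le
      ((conj_le_coe_iff_of_bot_lt hf.isProper_conj.1).2 fun w c hw => ?_))
    rw [inner_smul_right, ← div_eq_inv_mul, ← sub_div, div_le_iff₀ ht]
    linarith [h w c hw]

end Perspectives

/-! ### Conic duality for perspective constraints -/

section ConicModels

variable {d : ℕ} {f : EuclideanSpace ℝ (Fin d) → EReal}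

/-- The triples `(v, t, r)` with `t > 0` and `t f(v / t) = r`. -/
def perspGraph (f : EuclideanSpace ℝ (Fin d) → EReal) : Set (EuclideanSpace ℝ (Fin d) × ℝ × ℝ) :=
  {p | 0 < p.2.1 ∧ persp f p.1 p.2.1 = p.2.2}

/-- The triples `(v, t, r)` with `t > 0` and `t f(v / t) ≤ r`. -/
def perspEpi (f : EuclideanSpace ℝ (Fin d) → EReal) : Set (EuclideanSpace ℝ (Fin d) × ℝ × ℝ) :=
  {p | 0 < p.2.1 ∧ persp f p.1 p.2.1 ≤ p.2.2}

/-- A convex set `K` between the graph and the epigraph of the perspective of `f`, with a core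
point `p`. The epigraph itself has a core point only strictly above the graph; for affine `f` the
graph is a model whose core points lie on the graph. -/
structure IsConicModel (f : EuclideanSpace ℝ (Fin d) → EReal)
    (K : Set (EuclideanSpace ℝ (Fin d) × ℝ × ℝ)) (p : EuclideanSpace ℝ (Fin d) × ℝ × ℝ) :
    Prop where
  convex : Convex ℝ K
  graph_subset : perspGraph f ⊆ K
  subset_epi : K ⊆ perspEpi f
  core : IsCorePoint K p

theorem perspGraph_subset_perspEpi : perspGraph f ⊆ perspEpi f := fun _ hp => ⟨hp.1, hp.2.le⟩

theorem smul_mem_perspGraph {z : EuclideanSpace ℝ (Fin d)} {r t : ℝ} (hz : f z = r) (ht : 0 < t) :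
    (t • z, t, t * r) ∈ perspGraph f :=
  ⟨ht, by rw [persp_smul ht, hz, EReal.coe_mul]⟩

theorem exists_smul_eq_of_mem_perspEpi {p : EuclideanSpace ℝ (Fin d) × ℝ × ℝ}
    (hp : p ∈ perspEpi f) :
    ∃ (z : EuclideanSpace ℝ (Fin d)) (r : ℝ), f z ≤ r ∧ p = (p.2.1 • z, p.2.1, p.2.1 * r) := by
  obtain ⟨v, t, r⟩ := p
  have ht : t ≠ 0 := hp.1.ne'
  exact ⟨t⁻¹ • v, r / t, (persp_le_iff_of_pos hp.1).1 hp.2,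
    by rw [smul_inv_smul₀ ht, mul_div_cancel₀ _ ht]⟩

theorem smul_mem_perspEpi {z : EuclideanSpace ℝ (Fin d)} {r t : ℝ} (hz : f z ≤ r) (ht : 0 < t) :
    (t • z, t, t * r) ∈ perspEpi f :=
  ⟨ht, (persp_le_iff_of_pos ht).2 <| by
    rwa [inv_smul_smul₀ ht.ne', mul_div_cancel_left₀ _ ht.ne']⟩

theorem add_mem_perspEpi (hf : IsConvexFun f) {p q : EuclideanSpace ℝ (Fin d) × ℝ × ℝ}
    (hp : p ∈ perspEpi f) (hq : q ∈ perspEpi f) : p + q ∈ perspEpi f := by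
  obtain ⟨z, r, hz, hp'⟩ := exists_smul_eq_of_mem_perspEpi hp
  obtain ⟨w, s, hw, hq'⟩ := exists_smul_eq_of_mem_perspEpi hq
  have hp₀ := hp.1
  have hq₀ := hq.1
  have hsum := add_pos hp₀ hq₀
  rw [hp', hq']
  have := smul_mem_perspEpi (hf.le_combo hz hw (div_nonneg hp₀.le hsum.le)
    (div_nonneg hq₀.le hsum.le) (by rw [← add_div, div_self hsum.ne'])) hsum
  rwa [smul_add, smul_smul, smul_smul, mul_add, ← mul_assoc, ← mul_assoc,
    mul_div_cancel₀ _ hsum.ne', mul_div_cancel₀ _ hsum.ne'] at this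

theorem convex_perspEpi (hf : IsConvexFun f) : Convex ℝ (perspEpi f) :=
  ConvexCone.convex
    { carrier := perspEpi f
      smul_mem' := fun s hs p hp => by
        obtain ⟨z, r, hz, hp'⟩ := exists_smul_eq_of_mem_perspEpi hp
        have := smul_mem_perspEpi hz (mul_pos hs hp.1)
        rwa [mul_smul, mul_assoc, ← smul_eq_mul, ← smul_eq_mul s, ← Prod.smul_mk, ← Prod.smul_mk,
          ← hp'] at this
      add_mem' := fun _ hp _ hq => add_mem_perspEpi hf hp hq }

theorem mem_perspEpi_of_le {v : EuclideanSpace ℝ (Fin d)} {t r r' : ℝ}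
    (h : (v, t, r) ∈ perspEpi f) (hr : r ≤ r') : (v, t, r') ∈ perspEpi f :=
  ⟨h.1, h.2.trans (EReal.coe_le_coe_iff.2 hr)⟩

theorem isCorePoint_perspEpi (hf : IsProper f) (hc : IsConvexFun f) {v₀ : EuclideanSpace ℝ (Fin d)}
    {t₀ r₀ : ℝ} (ht₀ : 0 < t₀) (hcore : IsCorePoint (dom f) (t₀⁻¹ • v₀))
    (hr₀ : persp f v₀ t₀ < r₀) : IsCorePoint (perspEpi f) (v₀, t₀, r₀) := by
  obtain ⟨z₀, rfl⟩ : ∃ z₀, t₀ • z₀ = v₀ := ⟨t₀⁻¹ • v₀, smul_inv_smul₀ ht₀.ne' v₀⟩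
  rw [inv_smul_smul₀ ht₀.ne'] at hcore
  refine ⟨⟨ht₀, hr₀.le⟩, fun p hp => ?_⟩
  obtain ⟨z, r, hz, hp'⟩ := exists_smul_eq_of_mem_perspEpi hp
  have ht : 0 < p.2.1 := hp.1
  generalize p.2.1 = t at hp' ht
  obtain ⟨c₀, hc₀⟩ := hf.exists_real hcore.1
  obtain ⟨δ, hδdom, hδ : 0 < δ⟩ := ((hcore.2 z (hz.trans_lt (EReal.coe_lt_top r))).and
    self_mem_nhdsWithin).exists
  obtain ⟨M, hM⟩ := hf.exists_real hδdom
  have hlt : t₀ * c₀ < r₀ := by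
    rwa [persp_smul ht₀, hc₀, ← EReal.coe_mul, EReal.coe_lt_coe_iff] at hr₀
  -- The shifted point is a conic combination of the scaled graph points over `z₀` and over
  -- `z₀ - δ • (z - z₀)`, with the coefficients `κ ε` and `η ε`, plus a vertical slack.
  let η : ℝ → ℝ := fun ε => ε * t / δ
  let κ : ℝ → ℝ := fun ε => (1 + ε) * t₀ - ε * t - η ε
  have hκ : ∀ᶠ ε in 𝓝[>] 0, 0 < κ ε :=
    nhdsWithin_le_nhds <| ((by fun_prop : Continuous κ).tendsto 0).eventually_const_lt
      (by simpa [κ, η] using ht₀)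
  have hslack : ∀ᶠ ε in 𝓝[>] 0, η ε * M + κ ε * c₀ < (1 + ε) * r₀ - ε * (t * r) :=
    nhdsWithin_le_nhds <| Tendsto.eventually_lt
      ((by fun_prop : Continuous fun ε => η ε * M + κ ε * c₀).tendsto 0)
      ((by fun_prop : Continuous fun ε : ℝ => (1 + ε) * r₀ - ε * (t * r)).tendsto 0)
      (by simpa [κ, η] using hlt)
  filter_upwards [hκ, hslack, self_mem_nhdsWithin] with ε hκ hslack hε
  have hη : 0 < η ε := div_pos (mul_pos hε ht) hδ
  refine mem_perspEpi_of_le (r := η ε * M + κ ε * c₀) ?_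
    (hslack.le.trans_eq (by simp only [hp', Prod.snd_sub, Prod.smul_snd, smul_eq_mul]; ring))
  convert add_mem_perspEpi hc (smul_mem_perspEpi hM.le hη) (smul_mem_perspEpi hc₀.le hκ) using 2
  · have hηδ : η ε * δ = ε * t := div_mul_cancel₀ _ hδ.ne'
    simp only [hp', Prod.fst_sub, Prod.smul_fst, Prod.mk_add_mk, smul_sub, smul_smul, hηδ, κ]
    module
  · simp only [hp', Prod.snd_sub, Prod.smul_snd, Prod.fst_sub, Prod.smul_fst, smul_eq_mul,
      Prod.mk_add_mk, κ]
    ring_nf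

theorem mem_perspGraph_iff_of_forall_eq {a : EuclideanSpace ℝ (Fin d) →ᵃ[ℝ] ℝ}
    (ha : ∀ z, f z = a z) {p : EuclideanSpace ℝ (Fin d) × ℝ × ℝ} :
    p ∈ perspGraph f ↔ 0 < p.2.1 ∧ a.linear p.1 + p.2.1 * a 0 = p.2.2 := by
  refine and_congr_right fun ht => ?_
  have hdecomp : a (p.2.1⁻¹ • p.1) = a.linear (p.2.1⁻¹ • p.1) + a 0 := congrFun a.decomp _
  rw [persp, if_pos ht, ha, ← EReal.coe_mul, EReal.coe_eq_coe_iff, hdecomp, map_smul, mul_add,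
    smul_eq_mul, mul_inv_cancel_left₀ ht.ne']

theorem isConicModel_perspGraph (hf : IsLinearOn Set.univ f)
    {p : EuclideanSpace ℝ (Fin d) × ℝ × ℝ} (hp : p ∈ perspGraph f) :
    IsConicModel f (perspGraph f) p := by
  obtain ⟨a, ha⟩ := hf
  have hmem {q} := mem_perspGraph_iff_of_forall_eq (fun z => ha z trivial) (p := q)
  refine ⟨fun q hq q' hq' s s' hs hs' hss' => hmem.2 ?_, subset_rfl, perspGraph_subset_perspEpi,
    hp, fun q hq => ?_⟩
  · rw [hmem] at hq hq'
    refine ⟨convex_Ioi (0 : ℝ) hq.1 hq'.1 hs hs' hss', ?_⟩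
    simp only [Prod.fst_add, Prod.smul_fst, Prod.snd_add, Prod.smul_snd, map_add, map_smul,
      smul_eq_mul, ← hq.2, ← hq'.2]
    ring
  · rw [hmem] at hp hq
    have hpos : ∀ᶠ ε : ℝ in 𝓝[>] 0, 0 < p.2.1 - ε * (q.2.1 - p.2.1) :=
      nhdsWithin_le_nhds <| ((by fun_prop : Continuous fun ε : ℝ =>
        p.2.1 - ε * (q.2.1 - p.2.1)).tendsto 0).eventually_const_lt (by simpa using hp.1)
    refine hpos.mono fun ε hε => hmem.2 ⟨hε, ?_⟩
    simp only [Prod.fst_sub, Prod.smul_fst, Prod.snd_sub, Prod.smul_snd, map_sub, map_smul,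
      smul_eq_mul, ← hp.2, ← hq.2]
    ring

theorem exists_isConicModel (hf : IsProper f) (hc : IsConvexFun f)
    {v₀ : EuclideanSpace ℝ (Fin d)} {t₀ r₀ : ℝ} (ht₀ : 0 < t₀)
    (hcore : IsCorePoint (dom f) (t₀⁻¹ • v₀)) (hr₀ : persp f v₀ t₀ ≤ r₀)
    (h : ¬ IsLinearOn Set.univ f → persp f v₀ t₀ < r₀) :
    ∃ K, ∃ r ≤ r₀, IsConicModel f K (v₀, t₀, r) := by
  by_cases hlin : IsLinearOn Set.univ f
  · obtain ⟨c, hc⟩ := hf.exists_real hcore.1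
    have hpersp : persp f v₀ t₀ = ((t₀ * c : ℝ) : EReal) := by
      rw [persp, if_pos ht₀, hc, EReal.coe_mul]
    rw [hpersp, EReal.coe_le_coe_iff] at hr₀
    exact ⟨_, _, hr₀, isConicModel_perspGraph hlin ⟨ht₀, hpersp⟩⟩
  · exact ⟨_, r₀, le_rfl, convex_perspEpi hc, perspGraph_subset_perspEpi, subset_rfl,
      isCorePoint_perspEpi hf hc ht₀ hcore (h hlin)⟩

namespace IsConicModel

variable {K : Set (EuclideanSpace ℝ (Fin d) × ℝ × ℝ)} {p : EuclideanSpace ℝ (Fin d) × ℝ × ℝ}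

theorem smul_mem (hK : IsConicModel f K p) {z : EuclideanSpace ℝ (Fin d)} {r t : ℝ} (hz : f z = r)
    (ht : 0 < t) : (t • z, t, t * r) ∈ K :=
  hK.graph_subset (smul_mem_perspGraph hz ht)

theorem exists_eq_coe (hK : IsConicModel f K p) (hf : ∀ z, ⊥ < f z) :
    ∃ (z : EuclideanSpace ℝ (Fin d)) (r : ℝ), f z = r := by
  obtain ⟨z, r, hz, -⟩ := exists_smul_eq_of_mem_perspEpi (hK.subset_epi hK.core.1)
  exact ⟨z, (f z).toReal,
    (EReal.coe_toReal (hz.trans_lt (EReal.coe_lt_top r)).ne (hf z).ne').symm⟩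

end IsConicModel

end ConicModels

section ConicDuality

theorem nonneg_of_forall_pos_nonneg_add_sum {ι : Type*} [Fintype ι] {c : ℝ} {φ : ι → ℝ}
    (h : ∀ s : ι → ℝ, (∀ i, 0 < s i) → 0 ≤ c + ∑ i, s i * φ i) : 0 ≤ c ∧ ∀ i, 0 ≤ φ i := by
  classical
  have hclosed : IsClosed {s : ι → ℝ | 0 ≤ c + ∑ i, s i * φ i} :=
    isClosed_le continuous_const (by fun_prop)
  have hnonneg : ∀ s : ι → ℝ, (∀ i, 0 ≤ s i) → 0 ≤ c + ∑ i, s i * φ i := fun s hs =>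
    closure_minimal (s := Set.univ.pi fun _ : ι => Set.Ioi (0 : ℝ))
      (fun s hs => h s fun i => hs i trivial) hclosed <| by
        rw [closure_pi_set]
        exact fun i _ => by rw [closure_Ioi]; exact hs i
  refine ⟨by simpa using hnonneg 0 fun _ => le_rfl, fun i => ?_⟩
  have hsingle : ∀ s : ℝ, 0 ≤ s → 0 ≤ c + s * φ i := fun s hs => by
    have := hnonneg (Pi.single i s) (Pi.single_nonneg (i := i) (α := fun _ => ℝ) |>.2 hs)
    simpa only [Pi.single_apply, ite_mul, zero_mul, Finset.sum_ite_eq', Finset.mem_univ,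
      if_true] using this
  have hneg := apply_nonpos_of_forall_apply_le (p := fun _ : Unit => -LinearMap.id)
    (a := 0) (l := -φ i • LinearMap.id) (c := c) (x₀ := (0 : ℝ)) (y := 1)
    (fun s hs => by
      have := hsingle s (neg_nonpos.1 (hs ()))
      simp only [LinearMap.smul_apply, LinearMap.id_apply, smul_eq_mul]
      linarith) (by simp) (by simp)
  simpa using hneg

theorem eq_zero_of_forall_nonneg_add {V : Type*} [AddCommGroup V] [Module ℝ V]
    {l : Module.Dual ℝ V} {c : ℝ} (h : ∀ x, 0 ≤ l x + c) : l = 0 := by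
  have hnonneg (y : V) : -l y ≤ 0 :=
    apply_nonpos_of_forall_apply_le (p := fun k : Empty => k.elim) (a := 0) (l := -l)
      (fun x _ => neg_le_iff_add_nonneg'.2 (h x)) (x₀ := 0) (by simp) (by simp)
  ext y
  have := hnonneg (-y)
  rw [map_neg, neg_neg] at this
  exact this.antisymm (neg_nonpos.1 (hnonneg y))

variable {d : ℕ} {κ ι X F : Type*} [Fintype κ] [Fintype ι] [NormedAddCommGroup X]
  [NormedSpace ℝ X] [FiniteDimensional ℝ X] [AddCommGroup F] [Module ℝ F] [FiniteDimensional ℝ F]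
  {f : κ → EuclideanSpace ℝ (Fin d) → EReal} {A : κ → X →ₗ[ℝ] EuclideanSpace ℝ (Fin d)}
  {B R : κ → Module.Dual ℝ X} {b : κ → ℝ} {p : ι → Module.Dual ℝ X} {a : ι → ℝ} {Q : X →ₗ[ℝ] F}
  {e : F} {l : Module.Dual ℝ X} {c : ℝ} {x₀ : X}

theorem exists_conic_multipliers {K : κ → Set (EuclideanSpace ℝ (Fin d) × ℝ × ℝ)}
    (hK : ∀ k, ∃ r ≤ R k x₀, IsConicModel (f k) (K k) (A k x₀, B k x₀ + b k, r))
    (hx₀ : ∀ i, p i x₀ ≤ a i) (hQ : Q x₀ = e)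
    (h : ∀ x, (∀ i, p i x ≤ a i) → Q x = e →
      (∀ k, (A k x, B k x + b k, R k x) ∈ perspEpi (f k)) → l x ≤ c) :
    ∃ (η : ι → ℝ) (θ : Module.Dual ℝ F) (ν s : κ → ℝ) (y : κ → EuclideanSpace ℝ (Fin d)),
      (∀ i, 0 ≤ η i) ∧ (∀ k, 0 ≤ ν k) ∧ ∀ x, ∀ q ∈ Set.univ.pi K,
        l x - c ≤ ∑ i, η i * (p i x - a i) + θ (Q x - e) + ∑ k, (ν k * ((q k).2.2 - R k x) +
          inner ℝ (A k x - (q k).1) (y k) + s k * ((q k).2.1 - (B k x + b k))) := by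
  classical
  choose r hr hK using hK
  let fst : X × (κ → EuclideanSpace ℝ (Fin d) × ℝ × ℝ) →ₗ[ℝ] X := LinearMap.fst ℝ _ _
  let q' (k : κ) : X × (κ → EuclideanSpace ℝ (Fin d) × ℝ × ℝ) →ₗ[ℝ]
      EuclideanSpace ℝ (Fin d) × ℝ × ℝ := LinearMap.proj k ∘ₗ LinearMap.snd ℝ _ _
  let link : X × (κ → EuclideanSpace ℝ (Fin d) × ℝ × ℝ) →ₗ[ℝ] κ → EuclideanSpace ℝ (Fin d) × ℝ :=
    LinearMap.pi fun k => (LinearMap.fst ℝ _ _ ∘ₗ q' k - A k ∘ₗ fst).prod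
      (LinearMap.fst ℝ _ _ ∘ₗ LinearMap.snd ℝ _ _ ∘ₗ q' k - B k ∘ₗ fst)
  have hcore : IsCorePoint (Set.univ ×ˢ Set.univ.pi K)
      (x₀, fun k => (A k x₀, B k x₀ + b k, r k)) :=
    have hpi := isCorePoint_pi fun k => (hK k).core
    ⟨⟨trivial, hpi.1⟩, fun z hz => (hpi.2 z.2 hz.2).mono fun _ h => ⟨trivial, h⟩⟩
  obtain ⟨η, θ, hη, hθ⟩ := exists_multipliers_of_eq (l := l ∘ₗ fst) (c := c)
    (p := Sum.elim (fun i => p i ∘ₗ fst)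
      fun k => LinearMap.snd ℝ _ _ ∘ₗ LinearMap.snd ℝ _ _ ∘ₗ q' k - R k ∘ₗ fst)
    (a := Sum.elim a 0) (Q := (Q ∘ₗ fst).prod link) (b := (e, fun k => (0, b k)))
    (convex_univ.prod (convex_pi fun k _ => (hK k).convex)) hcore
    (by rintro (i | k); exacts [hx₀ i, sub_nonpos.2 (hr k)])
    (Prod.ext hQ <| by ext1 k; simp [link, q', fst])
    (fun x hx hxa hxQ => h x.1 (fun i => hxa (.inl i)) (congrArg Prod.fst hxQ) fun k => by
      have hlink := congrFun (congrArg Prod.snd hxQ) k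
      have hA : (x.2 k).1 = A k x.1 := sub_eq_zero.1 (congrArg Prod.fst hlink)
      have hB : (x.2 k).2.1 = B k x.1 + b k := sub_eq_iff_eq_add'.1 (congrArg Prod.snd hlink)
      rw [← hA, ← hB]
      exact mem_perspEpi_of_le ((hK k).subset_epi (hx.2 k trivial)) (sub_nonpos.1 (hxa (.inr k))))
  choose y s hys using fun k => exists_eq_inner_add_mul
    (θ ∘ₗ LinearMap.inr ℝ F _ ∘ₗ LinearMap.single ℝ (fun _ => EuclideanSpace ℝ (Fin d) × ℝ) k)
  refine ⟨fun i => η (.inl i), θ ∘ₗ LinearMap.inl ℝ F _, fun k => η (.inr k), s, fun k => -y k,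
    fun i => hη _, fun k => hη _, fun x q hq => (hθ (x, q) ⟨trivial, hq⟩).trans_eq ?_⟩
  have hθlink : θ (0, link (x, q) - fun k => (0, b k)) =
      ∑ k, (inner ℝ ((q k).1 - A k x) (y k) + s k * ((q k).2.1 - B k x - b k)) := by
    rw [← LinearMap.inr_apply (R := ℝ), ← LinearMap.comp_apply,
      ← Finset.univ_sum_single (link (x, q) - fun k => (0, b k)), map_sum]
    exact Finset.sum_congr rfl fun k _ => by simpa [link, q', fst] using hys k _ _
  have hθ' : θ (((Q ∘ₗ fst).prod link) (x, q) - (e, fun k => (0, b k))) =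
      θ (Q x - e, 0) + θ (0, link (x, q) - fun k => (0, b k)) := by
    rw [← map_add, Prod.mk_add_mk, add_zero, zero_add]; rfl
  rw [hθ', hθlink, Fintype.sum_sum_type, add_add_add_comm, ← Finset.sum_add_distrib]
  refine congrArg₂ (· + ·) rfl (Finset.sum_congr rfl fun k _ => ?_)
  rw [inner_neg_right, ← inner_neg_left, neg_sub, sub_sub, ← add_assoc]
  simp [q', fst]

theorem exists_conic_certificate (hf : ∀ k z, ⊥ < f k z)
    (hK : ∀ k, ∃ K, ∃ r ≤ R k x₀, IsConicModel (f k) K (A k x₀, B k x₀ + b k, r))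
    (hx₀ : ∀ i, p i x₀ ≤ a i) (hQ : Q x₀ = e)
    (h : ∀ x, (∀ i, p i x ≤ a i) → Q x = e →
      (∀ k, (A k x, B k x + b k, R k x) ∈ perspEpi (f k)) → l x ≤ c) :
    ∃ (η : ι → ℝ) (θ : Module.Dual ℝ F) (ν s : κ → ℝ) (y : κ → EuclideanSpace ℝ (Fin d)),
      (∀ i, 0 ≤ η i) ∧ (∀ k, 0 ≤ ν k) ∧
      (∀ x, l x = ∑ i, η i * p i x + θ (Q x) +
        ∑ k, (inner ℝ (A k x) (y k) - s k * B k x - ν k * R k x)) ∧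
      ∑ i, η i * a i + θ e + ∑ k, s k * b k ≤ c ∧
      ∀ k z (r : ℝ), f k z = r → inner ℝ z (y k) - ν k * r ≤ s k := by
  classical
  choose K hK using hK
  obtain ⟨η, θ, ν, s, y, hη, hν, hmul⟩ := exists_conic_multipliers hK hx₀ hQ h
  choose _ _ hK using hK
  choose z r hzr using fun k => (hK k).exists_eq_coe (hf k)
  let slope : Module.Dual ℝ X := ∑ i, η i • p i - l + θ ∘ₗ Q +
    ∑ k, (innerₗ _ (y k) ∘ₗ A k - s k • B k - ν k • R k)
  have hslope (x : X) : slope x = ∑ i, η i * p i x - l x + θ (Q x) +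
      ∑ k, (inner ℝ (A k x) (y k) - s k * B k x - ν k * R k x) := by
    simp [slope, real_inner_comm (y _)]
  -- Graph points can be scaled by arbitrary positive factors, so their coefficients separate.
  have hsplit {z : κ → EuclideanSpace ℝ (Fin d)} {r : κ → ℝ} (hzr : ∀ k, f k (z k) = r k) (x : X) :
      0 ≤ slope x + (c - (∑ i, η i * a i + θ e + ∑ k, s k * b k)) ∧
        ∀ k, 0 ≤ s k - (inner ℝ (z k) (y k) - ν k * r k) := by
    refine nonneg_of_forall_pos_nonneg_add_sum fun t ht => ?_
    have := hmul x (fun k => (t k • z k, t k, t k * r k)) fun k _ => (hK k).smul_mem (hzr k) (ht k)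
    rw [hslope]
    simp only [mul_sub, mul_add, inner_sub_left, real_inner_smul_left, Finset.sum_add_distrib,
      Finset.sum_sub_distrib, map_sub] at this ⊢
    have hcomm (k : κ) : ν k * (t k * r k) = t k * (ν k * r k) := mul_left_comm _ _ _
    simp only [hcomm, mul_comm (s _) (t _)] at this
    linarith
  have hslope₀ : slope = 0 := eq_zero_of_forall_nonneg_add fun x => (hsplit hzr x).1
  refine ⟨η, θ, ν, s, y, hη, hν, fun x => ?_, sub_nonneg.1 ?_, fun k w ρ hw => ?_⟩
  · have := hslope x
    rw [hslope₀, LinearMap.zero_apply] at this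
    linarith
  · simpa using (hsplit hzr 0).1
  · have := (hsplit (z := Function.update z k w) (r := Function.update r k ρ)
      (fun k' => by rcases eq_or_ne k' k with rfl | hk <;> simp [*]) 0).2 k
    simpa using this

end ConicDuality

/-! ### Block form of the finite convex programs -/

namespace APWVar

variable {d : ℕ} {I J L : Type*}

/-- The scaling factors `1`, `β_j` and `ν_{iℓ}` of the conjugates in (AP-W') as one family. The
block `none` belongs to `-g_i`, the blocks `some (.inl j)` to `h_j` and `some (.inr l)` to `c_l`. -/
def weight (x : APWVar d I J L) : I → Option (J ⊕ L) → ℝ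
  | _, none => 1
  | _, some (.inl j) => x.beta j
  | i, some (.inr l) => x.nu i l

/-- The vectors `y⁽⁰⁾`, `y⁽¹⁾` and `y⁽²⁾` of (AP-W') as one family. -/
def dualVec (x : APWVar d I J L) : I → Option (J ⊕ L) → EuclideanSpace ℝ (Fin d)
  | i, none => x.y0 i
  | i, some (.inl j) => x.y1 i j
  | i, some (.inr l) => x.y2 i l

/-- The decision variables of (AP-W') whose vectors are given as one family. -/
def ofDualVec (α : ℝ) (β : J → ℝ) (ν : I → L → ℝ)
    (y : I → Option (J ⊕ L) → EuclideanSpace ℝ (Fin d)) : APWVar d I J L :=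
  (α, β, fun i => y i none, fun i j => y i (some (.inl j)), fun i l => y i (some (.inr l)), ν)

theorem dualVec_ofDualVec (α : ℝ) (β : J → ℝ) (ν : I → L → ℝ)
    (y : I → Option (J ⊕ L) → EuclideanSpace ℝ (Fin d)) : (ofDualVec α β ν y).dualVec = y := by
  ext1 i
  ext1 (_ | _ | _) <;> rfl

theorem isLinearMap_ofDualVec : IsLinearMap ℝ
    (ofDualVec 0 0 0 : (I → Option (J ⊕ L) → EuclideanSpace ℝ (Fin d)) → APWVar d I J L) :=
  ⟨fun _ _ => by ext <;> simp [ofDualVec], fun _ _ => by ext <;> simp [ofDualVec]⟩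

theorem isLinearMap_dualVec (i : I) (b : Option (J ⊕ L)) :
    IsLinearMap ℝ fun x : APWVar d I J L => x.dualVec i b := by
  rcases b with _ | _ | _ <;> exact ⟨fun _ _ => rfl, fun _ _ => rfl⟩

theorem isLinearMap_weight_sub_weight_zero (i : I) (b : Option (J ⊕ L)) :
    IsLinearMap ℝ fun x : APWVar d I J L => x.weight i b - weight (0 : APWVar d I J L) i b := by
  rcases b with _ | _ | _ <;> constructor <;> simp [weight, beta, nu]

theorem weight_sub_smul_sub (x y : APWVar d I J L) (ε : ℝ) (i : I) (b : Option (J ⊕ L)) :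
    (x - ε • (y - x)).weight i b = x.weight i b - ε * (y.weight i b - x.weight i b) := by
  rcases b with _ | _ | _ <;> simp [weight, beta, nu]

theorem dualVec_sub_smul_sub (x y : APWVar d I J L) (ε : ℝ) (i : I) (b : Option (J ⊕ L)) :
    (x - ε • (y - x)).dualVec i b = x.dualVec i b - ε • (y.dualVec i b - x.dualVec i b) := by
  have h := isLinearMap_dualVec (d := d) i b
  rw [h.map_sub, h.map_smul, h.map_sub]

end APWVar

namespace ADBVar

variable {d : ℕ} {I J L : Type*}

/-- The bounds `-τ_i`, `ω_{ij}` and `0` on the perspectives in (AD-B') as one family. -/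
def level (x : ADBVar d I J) : I → Option (J ⊕ L) → ℝ
  | i, none => -x.tau i
  | i, some (.inl j) => x.omega i j
  | _, some (.inr _) => 0

theorem isLinearMap_level (i : I) (b : Option (J ⊕ L)) :
    IsLinearMap ℝ fun x : ADBVar d I J => x.level i b := by
  rcases b with _ | _ | _ <;> constructor <;> simp [level, tau, omega, add_comm]

end ADBVar

/-- The name of the constraint on the perspective of a block function in (AD-B'). -/
def ADBIneq.ofBlock {I J L : Type*} : I → Option (J ⊕ L) → ADBIneq I J L
  | i, none => .disutilityPiece i
  | i, some (.inl j) => .momentPiece i j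
  | i, some (.inr l) => .supp i l

theorem ADBIneq.forall_iff {I J L : Type*} {P : ADBIneq I J L → Prop} :
    (∀ k, P k) ↔ (∀ j, P (.moment j)) ∧ (∀ i, P (.lamSign i)) ∧ ∀ i b, P (.ofBlock i b) :=
  ⟨fun h => ⟨fun _ => h _, fun _ => h _, fun _ _ => h _⟩, fun ⟨hm, hl, hb⟩ => by
    rintro (j | ⟨i, l⟩ | ⟨i, j⟩ | i | i)
    exacts [hm j, hb i (some (.inr l)), hb i (some (.inl j)), hb i none, hl i]⟩

theorem APWIneq.forall_iff {I J L : Type*} {P : APWIneq I J L → Prop} :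
    (∀ k, P k) ↔ (∀ j, P (.betaSign j)) ∧ (∀ i l, P (.nuSign i l)) ∧ ∀ i, P (.piece i) :=
  ⟨fun h => ⟨fun _ => h _, fun _ _ => h _, fun _ => h _⟩, fun ⟨hβ, hν, hp⟩ => by
    rintro (i | j | ⟨i, l⟩)
    exacts [hp i, hβ j, hν i l]⟩

namespace Data

section

variable {d : ℕ} {I J L : Type*} (D : Data d I J L)

/-- The functions `-g_i`, `h_j` and `c_ℓ` that are paired with the scaling factor `λ_i`. -/
noncomputable def block : I → Option (J ⊕ L) → EuclideanSpace ℝ (Fin d) → EReal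
  | i, none => fun z => -D.g i z
  | _, some (.inl j) => D.h j
  | _, some (.inr l) => D.c l

theorem isPCC_block (hG : ∀ i, IsPCC (fun z => -D.g i z)) (hH : ∀ j, IsPCC (D.h j))
    (hC : ∀ l, IsPCC (D.c l)) : ∀ i b, IsPCC (D.block i b)
  | i, none => hG i
  | _, some (.inl j) => hH j
  | _, some (.inr l) => hC l

end

section ADB

variable {d : ℕ} {I J L : Type*} [Fintype I] {D : Data d I J L}

theorem adbIneq_ofBlock (i : I) (b : Option (J ⊕ L)) (x : ADBVar d I J) :
    D.adbIneq (.ofBlock i b) x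
      = persp (D.block i b) (x.ups i) (x.lam i) - (x.level i b : EReal) := by
  rcases b with _ | j | l
  · simp only [ADBIneq.ofBlock, adbIneq, block, ADBVar.level, concavePersp, EReal.coe_neg]
    rw [sub_eq_add_neg, sub_eq_add_neg, neg_neg, neg_neg, add_comm]
  · rfl
  · simp [ADBIneq.ofBlock, adbIneq, block, ADBVar.level]

theorem mem_adbConstraints_iff {x : ADBVar d I J} :
    x ∈ D.adbConstraints.set ↔ ∑ i, x.lam i = 1 ∧ (∀ j, ∑ i, x.omega i j ≤ D.mu j) ∧
      (∀ i, 0 ≤ x.lam i) ∧ ∀ i b, persp (D.block i b) (x.ups i) (x.lam i) ≤ x.level i b := by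
  change (∀ k, D.adbIneq k x ≤ 0) ∧ (∀ _ : Unit, ((∑ i, x.lam i - 1 : ℝ) : EReal) = 0) ↔ _
  simp only [ADBIneq.forall_iff, adbIneq_ofBlock, EReal.sub_nonpos]
  simp only [adbIneq, EReal.coe_nonpos, EReal.coe_eq_zero, sub_nonpos, sub_eq_zero, neg_nonpos,
    forall_const]
  tauto

theorem isCorePoint_of_isSlaterPoint_adb {x : ADBVar d I J}
    (hx : D.adbConstraints.IsSlaterPoint x) {i : I} (hlam : 0 < x.lam i) (b : Option (J ⊕ L)) :
    IsCorePoint (dom (D.block i b)) ((x.lam i)⁻¹ • x.ups i) := by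
  classical
  have hdom {y : ADBVar d I J} (hy : y.lam i = x.lam i) :
      y ∈ dom (D.adbIneq (.ofBlock i b)) ↔ (x.lam i)⁻¹ • y.ups i ∈ dom (D.block i b) := by
    rw [dom, Set.mem_ofPred_eq, adbIneq_ofBlock, ereal_sub_coe_lt_top_iff, hy, persp,
      if_pos hlam, dom, Set.mem_ofPred_eq, ereal_coe_pos_mul_lt_top_iff hlam]
  have hcore := isCorePoint_of_mem_intrinsicInterior (hx.ri_ineq (.ofBlock i b))
  refine ⟨(hdom rfl).1 hcore.1, fun z hz => ?_⟩
  let y : ADBVar d I J := (x.tau, x.lam, x.omega, Function.update x.ups i (x.lam i • z))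
  have hyi : y.ups i = x.lam i • z := by simp [y, ADBVar.ups]
  have hy : y ∈ dom (D.adbIneq (.ofBlock i b)) :=
    (hdom (y := y) rfl).2 <| by rwa [hyi, inv_smul_smul₀ hlam.ne']
  refine (hcore.2 y hy).mono fun ε hε => ?_
  have hups : (x - ε • (y - x)).ups i = x.ups i - ε • (x.lam i • z - x.ups i) := by
    rw [← hyi]; rfl
  have := (hdom (by simp [y, ADBVar.lam])).1 hε
  rwa [hups, smul_sub, smul_comm _ ε, smul_sub, inv_smul_smul₀ hlam.ne'] at this

theorem isLinearOn_block_of_adb {i : I} {b : Option (J ⊕ L)}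
    (h : IsLinearOn D.adbConstraints.ground (D.adbIneq (.ofBlock i b))) :
    IsLinearOn Set.univ (D.block i b) := by
  classical
  obtain ⟨a, ha⟩ := h
  let unitPoint (z : EuclideanSpace ℝ (Fin d)) : ADBVar d I J := (0, 1, 0, Pi.single i z)
  let ι : EuclideanSpace ℝ (Fin d) →ₗ[ℝ] ADBVar d I J :=
    LinearMap.inr ℝ _ _ ∘ₗ LinearMap.inr ℝ _ _ ∘ₗ LinearMap.inr ℝ _ _ ∘ₗ
      LinearMap.single ℝ (fun _ => EuclideanSpace ℝ (Fin d)) i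
  have hι (z : EuclideanSpace ℝ (Fin d)) : ι z + (0, 1, 0, 0) = unitPoint z := by
    simp [ι, unitPoint]
  refine ⟨a.comp (ι.toAffineMap + AffineMap.const ℝ _ (0, 1, 0, 0)), fun z _ => ?_⟩
  have hlevel : (unitPoint z).level i b = 0 := by
    rcases b with _ | _ | _ <;> simp [ADBVar.level, unitPoint, ADBVar.tau, ADBVar.omega]
  have := ha (unitPoint z) fun _ => zero_le_one
  rw [adbIneq_ofBlock, hlevel, EReal.coe_zero, sub_zero] at this
  simpa [unitPoint, ADBVar.ups, ADBVar.lam, persp_one, ← hι] using this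

end ADB

section APW

variable {d : ℕ} {I J L : Type*} [Fintype J] [Fintype L] {D : Data d I J L}

theorem apwIneq_piece (i : I) (x : APWVar d I J L) :
    D.apwIneq (.piece i) x
      = ∑ b, persp (conj (D.block i b)) (x.dualVec i b) (x.weight i b) - (x.alpha : EReal) := by
  simp only [apwIneq, Fintype.sum_option, Fintype.sum_sum_type, block, APWVar.dualVec,
    APWVar.weight, persp_one, add_assoc]

theorem apwIneq_piece_nonpos_iff (hf : ∀ i b, IsPCC (D.block i b)) {i : I} {x : APWVar d I J L} :
    D.apwIneq (.piece i) x ≤ 0 ↔ ∃ ρ : Option (J ⊕ L) → ℝ,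
      (∀ b, persp (conj (D.block i b)) (x.dualVec i b) (x.weight i b) ≤ ρ b) ∧
      ∑ b, ρ b ≤ x.alpha := by
  rw [apwIneq_piece, EReal.sub_nonpos]
  constructor
  · intro h
    obtain ⟨ρ, hρ, hsum⟩ :=
      exists_real_of_ereal_sum_le (fun b _ => (hf i b).bot_lt_persp_conj _ _) h
    exact ⟨ρ, fun b => (hρ b (Finset.mem_univ b)).le, hsum⟩
  · rintro ⟨ρ, hρ, hsum⟩
    refine (Finset.sum_le_sum fun b _ => hρ b).trans ?_
    rwa [← ereal_coe_sum, EReal.coe_le_coe_iff]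

theorem forall_apwEqn_eq_zero_iff {x : APWVar d I J L} :
    (∀ m, D.apwEqn m x = 0) ↔ ∀ i, ∑ b, x.dualVec i b = 0 := by
  simp only [apwEqn, EReal.coe_eq_zero, Prod.forall, Fintype.sum_option, Fintype.sum_sum_type,
    APWVar.dualVec, ← add_assoc]
  exact forall_congr' fun i => ⟨fun h => by ext k; exact h k, fun h k => by rw [h]; rfl⟩

theorem mem_apwConstraints_iff (hf : ∀ i b, IsPCC (D.block i b)) {x : APWVar d I J L} :
    x ∈ D.apwConstraints.set ↔ (∀ j, 0 ≤ x.beta j) ∧ (∀ i l, 0 ≤ x.nu i l) ∧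
      (∀ i, ∑ b, x.dualVec i b = 0) ∧ ∀ i, ∃ ρ : Option (J ⊕ L) → ℝ,
        (∀ b, persp (conj (D.block i b)) (x.dualVec i b) (x.weight i b) ≤ ρ b) ∧
        ∑ b, ρ b ≤ x.alpha := by
  change (∀ k, D.apwIneq k x ≤ 0) ∧ (∀ m, D.apwEqn m x = 0) ↔ _
  simp only [APWIneq.forall_iff, apwIneq_piece_nonpos_iff hf, forall_apwEqn_eq_zero_iff]
  simp only [apwIneq, EReal.coe_nonpos, neg_nonpos]
  tauto

theorem mem_dom_apwIneq_piece_iff (hf : ∀ i b, IsPCC (D.block i b)) {i : I}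
    {x : APWVar d I J L} : x ∈ dom (D.apwIneq (.piece i)) ↔
      ∀ b, persp (conj (D.block i b)) (x.dualVec i b) (x.weight i b) < ⊤ := by
  rw [dom, Set.mem_ofPred_eq, apwIneq_piece, ereal_sub_coe_lt_top_iff]
  have hbot (b) := (hf i b).bot_lt_persp_conj (x.dualVec i b) (x.weight i b)
  constructor
  · intro h b
    obtain ⟨r, hr, -⟩ := EReal.lt_iff_exists_real_btwn.1 h
    obtain ⟨ρ, hρ, -⟩ := exists_real_of_ereal_sum_le (fun b _ => hbot b) hr.le
    rw [hρ b (Finset.mem_univ b)]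
    exact EReal.coe_lt_top _
  · intro h
    rw [Finset.sum_congr rfl fun b _ => (EReal.coe_toReal (h b).ne (hbot b).ne').symm,
      ← ereal_coe_sum]
    exact EReal.coe_lt_top _

theorem weight_pos_of_isSlaterPoint_apw (hf : ∀ i b, IsPCC (D.block i b)) {x : APWVar d I J L}
    (hx : D.apwConstraints.IsSlaterPoint x) (i : I) : ∀ b, 0 < x.weight i b
  | none => zero_lt_one
  | some b => by
    have hcore := isCorePoint_of_mem_intrinsicInterior (hx.ri_ineq (.piece i))
    have hnonneg (b) : 0 ≤ x.weight i b :=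
      nonneg_of_persp_lt_top ((mem_dom_apwIneq_piece_iff hf).1 hcore.1 b)
    choose w hw using fun i b => (hf i b).isProper_conj.2
    let larger (y : I → Option (J ⊕ L) → EuclideanSpace ℝ (Fin d)) : APWVar d I J L :=
      .ofDualVec 0 (x.beta + 1) (x.nu + 1) y
    have hsome (y) (b : J ⊕ L) : (larger y).weight i (some b) = x.weight i (some b) + 1 := by
      rcases b with _ | _ <;> rfl
    have hpos (y) : ∀ b, 0 < (larger y).weight i b
      | none => zero_lt_one
      | some b => by rw [hsome]; linarith [hnonneg (some b)]
    let y : APWVar d I J L := larger fun i b => (larger 0).weight i b • w i b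
    have hy : y ∈ dom (D.apwIneq (.piece i)) := (mem_dom_apwIneq_piece_iff hf).2 fun b => by
      have hweight : (larger 0).weight i b = y.weight i b := by rcases b with _ | _ | _ <;> rfl
      rw [APWVar.dualVec_ofDualVec, hweight, persp, if_pos (hpos _ b),
        inv_smul_smul₀ (hpos _ b).ne', ereal_coe_pos_mul_lt_top_iff (hpos _ b)]
      exact hw i b
    obtain ⟨ε, hmem, hε : 0 < ε⟩ := ((hcore.2 y hy).and self_mem_nhdsWithin).exists
    have := nonneg_of_persp_lt_top ((mem_dom_apwIneq_piece_iff hf).1 hmem (some b))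
    rw [APWVar.weight_sub_smul_sub, hsome] at this
    linarith

theorem isCorePoint_of_isSlaterPoint_apw (hf : ∀ i b, IsPCC (D.block i b)) {x : APWVar d I J L}
    (hx : D.apwConstraints.IsSlaterPoint x) (i : I) (b : Option (J ⊕ L)) :
    IsCorePoint (dom (conj (D.block i b))) ((x.weight i b)⁻¹ • x.dualVec i b) := by
  classical
  have hpos := weight_pos_of_isSlaterPoint_apw hf hx i b
  have hcore := isCorePoint_of_mem_intrinsicInterior (hx.ri_ineq (.piece i))
  have hmem := (mem_dom_apwIneq_piece_iff hf).1 hcore.1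
  have hdom (v) : persp (conj (D.block i b)) v (x.weight i b) < ⊤ ↔
      (x.weight i b)⁻¹ • v ∈ dom (conj (D.block i b)) := by
    rw [persp, if_pos hpos, dom, Set.mem_ofPred_eq, ereal_coe_pos_mul_lt_top_iff hpos]
  refine ⟨(hdom _).1 (hmem b), fun w hw => ?_⟩
  let y : APWVar d I J L := .ofDualVec 0 x.beta x.nu
    (Function.update x.dualVec i (Function.update (x.dualVec i) b (x.weight i b • w)))
  have hweight (b') : y.weight i b' = x.weight i b' := by rcases b' with _ | _ | _ <;> rfl
  have hvec : y.dualVec i = Function.update (x.dualVec i) b (x.weight i b • w) := by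
    rw [APWVar.dualVec_ofDualVec, Function.update_self]
  have hy : y ∈ dom (D.apwIneq (.piece i)) := (mem_dom_apwIneq_piece_iff hf).2 fun b' => by
    rw [hweight, hvec]
    rcases eq_or_ne b' b with rfl | hb
    · rwa [Function.update_self, hdom, inv_smul_smul₀ hpos.ne']
    · rw [Function.update_of_ne hb]
      exact hmem b'
  refine (hcore.2 y hy).mono fun ε hε => ?_
  have := (mem_dom_apwIneq_piece_iff hf).1 hε b
  rwa [APWVar.dualVec_sub_smul_sub, APWVar.weight_sub_smul_sub, hweight, sub_self, mul_zero,
    sub_zero, hdom, hvec, Function.update_self, smul_sub, smul_comm _ ε, smul_sub,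
    inv_smul_smul₀ hpos.ne'] at this

theorem isLinearOn_conj_block_of_apw (hf : ∀ i b, IsPCC (D.block i b)) {i : I}
    (h : IsLinearOn D.apwConstraints.ground (D.apwIneq (.piece i))) (b : Option (J ⊕ L)) :
    IsLinearOn Set.univ (conj (D.block i b)) := by
  classical
  obtain ⟨a, ha⟩ := h
  let single (z : EuclideanSpace ℝ (Fin d)) : I → Option (J ⊕ L) → EuclideanSpace ℝ (Fin d) :=
    Pi.single i (Pi.single b z)
  let unitPoint (z : EuclideanSpace ℝ (Fin d)) : APWVar d I J L := .ofDualVec 0 1 1 (single z)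
  have hsum (z) : ∑ b', conj (D.block i b') (single z i b') = a (unitPoint z) := by
    have hweight (b') : (unitPoint z).weight i b' = 1 := by rcases b' with _ | _ | _ <;> rfl
    have := ha (unitPoint z) ⟨fun _ => zero_le_one, fun _ _ => zero_le_one⟩
    change D.apwIneq (.piece i) _ = _ at this
    have halpha : (unitPoint z).alpha = 0 := rfl
    simpa only [apwIneq_piece, hweight, persp_one, halpha, EReal.coe_zero, sub_zero, unitPoint,
      APWVar.dualVec_ofDualVec] using this
  have hreal (z) := exists_real_of_ereal_sum_le
    (fun b' _ => (hf i b').isProper_conj.1 (single z i b')) (hsum z).le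
  choose ρ hρ _ using hreal
  let ι : EuclideanSpace ℝ (Fin d) →ₗ[ℝ] APWVar d I J L := APWVar.isLinearMap_ofDualVec.mk' _ ∘ₗ
    LinearMap.single ℝ (fun _ => Option (J ⊕ L) → EuclideanSpace ℝ (Fin d)) i ∘ₗ
      LinearMap.single ℝ (fun _ => EuclideanSpace ℝ (Fin d)) b
  have hι (z) : ι z + (0, 1, 0, 0, 0, 1) = unitPoint z := by
    ext <;> simp [ι, unitPoint, single, APWVar.ofDualVec]
  refine ⟨a.comp (ι.toAffineMap + AffineMap.const ℝ _ (0, 1, 0, 0, 0, 1)) -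
    AffineMap.const ℝ _ (∑ b' ∈ Finset.univ.erase b, ρ 0 b'), fun z _ => ?_⟩
  have hother : ∑ b' ∈ Finset.univ.erase b, ρ z b' = ∑ b' ∈ Finset.univ.erase b, ρ 0 b' :=
    Finset.sum_congr rfl fun b' hb' => by
      have hzero (z) : single z i b' = 0 := by simp [single, (Finset.mem_erase.1 hb').1]
      have hconj : conj (D.block i b') (single z i b') = conj (D.block i b') (single 0 i b') := by
        rw [hzero, hzero]
      rwa [hρ z b' (Finset.mem_univ _), hρ 0 b' (Finset.mem_univ _), EReal.coe_eq_coe_iff] at hconj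
  have hb : conj (D.block i b) z = ρ z b := by simpa [single] using hρ z b (Finset.mem_univ _)
  have hz := hsum z
  rw [Finset.sum_congr rfl (hρ z), ← ereal_coe_sum, EReal.coe_eq_coe_iff, ← hι,
    ← Finset.add_sum_erase _ _ (Finset.mem_univ b), hother] at hz
  rw [hb, EReal.coe_eq_coe_iff]
  exact eq_sub_of_add_eq hz

end APW

end Data

/-! ### Strong duality between (AP-W') and (AD-B') -/

namespace Data

section

variable {d : ℕ} {I J L : Type*} [Fintype I] {D : Data d I J L}

theorem exists_isConicModel_block_of_adb (hf : ∀ i b, IsPCC (D.block i b)) {x : ADBVar d I J}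
    (hx : D.adbConstraints.IsSlaterPoint x) {i : I} (hpos : 0 < x.lam i) (b : Option (J ⊕ L)) :
    ∃ K, ∃ r ≤ x.level i b, IsConicModel (D.block i b) K (x.ups i, x.lam i, r) := by
  refine exists_isConicModel (hf i b).proper (hf i b).convex hpos
    (isCorePoint_of_isSlaterPoint_adb hx hpos b)
    ((mem_adbConstraints_iff.1 hx.mem).2.2.2 i b) fun hlin => ?_
  have := hx.strict (.ofBlock i b) fun h => hlin (isLinearOn_block_of_adb h)
  change D.adbIneq _ x < 0 at this
  rwa [adbIneq_ofBlock, EReal.sub_neg (.inr (EReal.coe_ne_top _)) (.inr (EReal.coe_ne_bot _))]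
    at this

end

variable {d : ℕ} {I J L : Type*} [Fintype I] [Fintype J] [Fintype L] {D : Data d I J L}

theorem exists_multipliers_of_isSlaterPoint_adb (hf : ∀ i b, IsPCC (D.block i b))
    {x : ADBVar d I J} (hx : D.adbConstraints.IsSlaterPoint x) (hpos : ∀ i, 0 < x.lam i) {V : ℝ}
    (hV : ∀ x ∈ D.adbConstraints.set, (∀ i, 0 < x.lam i) → ∑ i, x.tau i ≤ V) :
    ∃ (η : J → ℝ) (θ : ℝ) (ν s : I → Option (J ⊕ L) → ℝ)
      (y : I → Option (J ⊕ L) → EuclideanSpace ℝ (Fin d)),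
      (∀ j, 0 ≤ η j) ∧ (∀ i b, 0 ≤ ν i b) ∧
      (∀ x : ADBVar d I J, ∑ i, x.tau i = ∑ j, η j * ∑ i, x.omega i j + θ * ∑ i, x.lam i +
        ∑ i, ∑ b, (inner ℝ (x.ups i) (y i b) - s i b * x.lam i - ν i b * x.level i b)) ∧
      ∑ j, η j * D.mu j + θ ≤ V ∧
      ∀ i b z (r : ℝ), D.block i b z = r → inner ℝ z (y i b) - ν i b * r ≤ s i b := by
  obtain ⟨hlam, homega, -, -⟩ := mem_adbConstraints_iff.1 hx.mem
  obtain ⟨η, θ, ν, s, y, hη, hν, hl, hle, hdual⟩ := exists_conic_certificate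
    (f := fun k : I × Option (J ⊕ L) => D.block k.1 k.2) (x₀ := x) (b := 0) (c := V)
    (A := fun k => IsLinearMap.mk' (fun x : ADBVar d I J => x.ups k.1)
      ⟨fun _ _ => rfl, fun _ _ => rfl⟩)
    (B := fun k => IsLinearMap.mk' (fun x : ADBVar d I J => x.lam k.1)
      ⟨fun _ _ => rfl, fun _ _ => rfl⟩)
    (R := fun k => (ADBVar.isLinearMap_level k.1 k.2).mk' _) (a := D.mu) (e := (1 : ℝ))
    (p := fun j => IsLinearMap.mk' (fun x : ADBVar d I J => ∑ i, x.omega i j)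
      ⟨fun _ _ => Finset.sum_add_distrib, fun _ _ => (Finset.mul_sum ..).symm⟩)
    (Q := IsLinearMap.mk' (fun x : ADBVar d I J => ∑ i, x.lam i)
      ⟨fun _ _ => Finset.sum_add_distrib, fun _ _ => (Finset.mul_sum ..).symm⟩)
    (l := IsLinearMap.mk' (fun x : ADBVar d I J => ∑ i, x.tau i)
      ⟨fun _ _ => Finset.sum_add_distrib, fun _ _ => (Finset.mul_sum ..).symm⟩)
    (fun k => (hf k.1 k.2).proper.1)
    (fun k => by simpa using exists_isConicModel_block_of_adb hf hx (hpos k.1) k.2)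
    homega hlam (fun x hω hsum hx => by
      have hx i b : 0 < x.lam i ∧ persp (D.block i b) (x.ups i) (x.lam i) ≤ x.level i b := by
        simpa [perspEpi] using hx (i, b)
      exact hV x (mem_adbConstraints_iff.2 ⟨hsum, hω, fun i => (hx i none).1.le,
        fun i b => (hx i b).2⟩) fun i => (hx i none).1)
  refine ⟨η, θ 1, fun i b => ν (i, b), fun i b => s (i, b), fun i b => y (i, b), hη,
    fun i b => hν (i, b), fun x => ?_, by simpa using hle, fun i b => hdual (i, b)⟩
  have hθ : θ (∑ i, x.lam i) = θ 1 * ∑ i, x.lam i := by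
    simpa [mul_comm] using θ.map_smul (∑ i, x.lam i) 1
  simpa only [Fintype.sum_prod_type, IsLinearMap.mk'_apply, hθ] using hl x

theorem exists_apw_le_of_isSlaterPoint_adb (hf : ∀ i b, IsPCC (D.block i b)) {x : ADBVar d I J}
    (hx : D.adbConstraints.IsSlaterPoint x) (hpos : ∀ i, 0 < x.lam i) {V : ℝ}
    (hV : ∀ x ∈ D.adbConstraints.set, (∀ i, 0 < x.lam i) → ∑ i, x.tau i ≤ V) :
    ∃ y ∈ D.apwConstraints.set, y.alpha + ∑ j, D.mu j * y.beta j ≤ V := by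
  classical
  obtain ⟨η, α, ν, s, y, hη, hν, hl, hle, hdual⟩ :=
    exists_multipliers_of_isSlaterPoint_adb hf hx hpos hV
  have htau (i : I) : ν i none = 1 := by
    have := hl (Pi.single i 1, 0, 0, 0)
    simpa [ADBVar.level, ADBVar.tau, ADBVar.omega, ADBVar.lam, ADBVar.ups, Fintype.sum_option,
      Fintype.sum_sum_type, Pi.single_apply, eq_comm] using this
  have homega (i : I) (j : J) : ν i (some (.inl j)) = η j := by
    have := hl (0, 0, Pi.single i (Pi.single j 1), 0)
    simp [ADBVar.level, ADBVar.tau, ADBVar.omega, ADBVar.lam, ADBVar.ups, Fintype.sum_option,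
      Fintype.sum_sum_type, Pi.single_apply, ite_apply] at this
    linarith
  have hlam (i : I) : ∑ b, s i b = α := by
    have := hl (0, Pi.single i 1, 0, 0)
    simp [ADBVar.level, ADBVar.tau, ADBVar.omega, ADBVar.lam, ADBVar.ups, Fintype.sum_option,
      Fintype.sum_sum_type, Pi.single_apply] at this ⊢
    linarith
  have hups (i : I) : ∑ b, y i b = 0 := by
    refine ext_inner_left ℝ fun v => ?_
    have : ∑ i', ∑ b, inner ℝ ((Pi.single i v : I → EuclideanSpace ℝ (Fin d)) i') (y i' b) = 0 := by
      simpa [ADBVar.level, ADBVar.tau, ADBVar.omega, ADBVar.lam, ADBVar.ups, Fintype.sum_option,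
        Fintype.sum_sum_type] using (hl (0, 0, 0, Pi.single i v)).symm
    rwa [Fintype.sum_eq_single i fun i' hi => by simp [hi], Pi.single_eq_same, ← inner_sum,
      ← inner_zero_right v] at this
  let x : APWVar d I J L := .ofDualVec α η (fun i l => ν i (some (.inr l))) y
  have hweight (i) : ∀ b, x.weight i b = ν i b
    | none => (htau i).symm
    | some (.inl j) => (homega i j).symm
    | some (.inr l) => rfl
  refine ⟨x, (mem_apwConstraints_iff hf).2 ⟨hη, fun i l => hν _ _,
    by rwa [APWVar.dualVec_ofDualVec], fun i => ⟨s i, fun b => ?_, (hlam i).le⟩⟩, ?_⟩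
  · rw [hweight, APWVar.dualVec_ofDualVec]
    exact (hf i b).persp_conj_le (hν i b) (hdual i b)
  · simpa only [x, APWVar.alpha, APWVar.beta, APWVar.ofDualVec, mul_comm, add_comm] using hle

end Data

theorem exists_real_lt_of_ereal_sum_lt {ι : Type*} {s : Finset ι} {e : ι → EReal} {a : ℝ}
    (he : ∀ i ∈ s, ⊥ < e i) (h : ∑ i ∈ s, e i < a) :
    ∃ ρ : ι → ℝ, (∀ i ∈ s, e i < ρ i) ∧ ∑ i ∈ s, ρ i ≤ a := by
  obtain ⟨c, hc, hca⟩ := EReal.lt_iff_exists_real_btwn.1 h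
  obtain ⟨ρ, hρ, hsum⟩ := exists_real_of_ereal_sum_le he hc.le
  have hca : 0 < a - c := sub_pos.2 (EReal.coe_lt_coe_iff.1 hca)
  refine ⟨fun i => ρ i + (a - c) / (s.card + 1), fun i hi => ?_, ?_⟩
  · rw [hρ i hi, EReal.coe_lt_coe_iff, lt_add_iff_pos_right]
    positivity
  · have : s.card * ((a - c) / (s.card + 1)) ≤ a - c := by
      rw [mul_div_left_comm]
      exact mul_le_of_le_one_right hca.le (div_le_one_of_le₀ (by linarith) (by positivity))
    rw [Finset.sum_add_distrib, Finset.sum_const, nsmul_eq_mul]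
    linarith

theorem eq_of_forall_sum_inner_eq_zero {E ι β : Type*} [NormedAddCommGroup E]
    [InnerProductSpace ℝ E] [Fintype ι] [Fintype β] {v : ι → β → E}
    (h : ∀ z : ι → β → E, (∀ i, ∑ b, z i b = 0) → ∑ i, ∑ b, inner ℝ (z i b) (v i b) = 0)
    (i : ι) (b b' : β) : v i b = v i b' := by
  classical
  refine ext_inner_left ℝ fun w => ?_
  have hsingle (b) : ∑ b', inner ℝ ((Pi.single b w : β → E) b') (v i b') = inner ℝ w (v i b) := by
    rw [Fintype.sum_eq_single b fun b' hb => by simp [hb], Pi.single_eq_same]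
  have hz := h (Pi.single i (Pi.single b w - Pi.single b' w)) fun i' => by
    rcases eq_or_ne i' i with rfl | hi <;> simp [*]
  rw [Fintype.sum_eq_single i fun i' hi => by simp [hi]] at hz
  simpa only [Pi.single_eq_same, Pi.sub_apply, inner_sub_left, Finset.sum_sub_distrib, hsingle,
    sub_eq_zero] using hz

namespace APWVar

variable {d : ℕ} {I J L : Type*} [Fintype J]

theorem isLinearMap_neg_alpha_add_sum (μ : J → ℝ) :
    IsLinearMap ℝ fun x : APWVar d I J L => -(x.alpha + ∑ j, μ j * x.beta j) :=
  ⟨fun x y => by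
    simp only [alpha, beta, Prod.fst_add, Prod.snd_add, Pi.add_apply, mul_add,
      Finset.sum_add_distrib]
    ring, fun _ _ => by simp [alpha, beta, Finset.mul_sum, mul_add, mul_left_comm]⟩

variable [Fintype L]

theorem isLinearMap_sum_sub_alpha (i : I) : IsLinearMap ℝ
    fun x : APWVar d I J L × (I → Option (J ⊕ L) → ℝ) => ∑ b, x.2 i b - x.1.alpha :=
  ⟨fun x y => by simp [alpha, Finset.sum_add_distrib, add_sub_add_comm],
    fun _ _ => by simp [alpha, Finset.mul_sum, mul_add, mul_sub]⟩

theorem isLinearMap_sum_dualVec : IsLinearMap ℝ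
    fun (x : APWVar d I J L) i => ∑ b, x.dualVec i b :=
  ⟨fun x y => by ext; simp [(isLinearMap_dualVec _ _).map_add, Finset.sum_add_distrib],
    fun _ _ => by
      ext1; simp only [(isLinearMap_dualVec _ _).map_smul, Pi.smul_apply, Finset.smul_sum]⟩

end APWVar

namespace Data

section

variable {d : ℕ} {I J L : Type*} [Fintype J] [Fintype L] {D : Data d I J L}

theorem exists_isConicModel_conj_block_of_apw (hf : ∀ i b, IsPCC (D.block i b))
    {x : APWVar d I J L} (hx : D.apwConstraints.IsSlaterPoint x) (i : I) :
    ∃ ρ : Option (J ⊕ L) → ℝ, (∀ b, ∃ K, ∃ r ≤ ρ b,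
      IsConicModel (conj (D.block i b)) K (x.dualVec i b, x.weight i b, r)) ∧
      ∑ b, ρ b ≤ x.alpha := by
  have hmodel {ρ : Option (J ⊕ L) → ℝ} (b)
      (hle : persp (conj (D.block i b)) (x.dualVec i b) (x.weight i b) ≤ ρ b)
      (hlt : ¬ IsLinearOn Set.univ (conj (D.block i b)) →
        persp (conj (D.block i b)) (x.dualVec i b) (x.weight i b) < ρ b) :=
    exists_isConicModel (hf i b).isProper_conj isConvexFun_conj
      (weight_pos_of_isSlaterPoint_apw hf hx i b) (isCorePoint_of_isSlaterPoint_apw hf hx i b)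
      hle hlt
  by_cases hlin : IsLinearOn D.apwConstraints.ground (D.apwIneq (.piece i))
  · obtain ⟨ρ, hρ, hsum⟩ := ((mem_apwConstraints_iff hf).1 hx.mem).2.2.2 i
    exact ⟨ρ, fun b => hmodel b (hρ b) fun h => absurd (isLinearOn_conj_block_of_apw hf hlin b) h,
      hsum⟩
  · have hlt : D.apwIneq (.piece i) x < 0 := hx.strict (.piece i) hlin
    rw [apwIneq_piece, EReal.sub_neg (.inr (EReal.coe_ne_top _)) (.inr (EReal.coe_ne_bot _))] at hlt
    obtain ⟨ρ, hρ, hsum⟩ :=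
      exists_real_lt_of_ereal_sum_lt (fun b _ => (hf i b).bot_lt_persp_conj _ _) hlt
    exact ⟨ρ, fun b => hmodel b (hρ b (Finset.mem_univ b)).le fun _ => hρ b (Finset.mem_univ b),
      hsum⟩

end

variable {d : ℕ} {I J L : Type*} [Fintype I] [Nonempty I] [Fintype J] [Fintype L] {D : Data d I J L}

theorem exists_multipliers_of_isSlaterPoint_apw (hf : ∀ i b, IsPCC (D.block i b))
    {x : APWVar d I J L} (hx : D.apwConstraints.IsSlaterPoint x) {W : ℝ}
    (hW : ∀ x ∈ D.apwConstraints.set, W ≤ x.alpha + ∑ j, D.mu j * x.beta j) :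
    ∃ (t : I → ℝ) (θ : Module.Dual ℝ (I → EuclideanSpace ℝ (Fin d)))
      (ν s : I → Option (J ⊕ L) → ℝ) (v : I → Option (J ⊕ L) → EuclideanSpace ℝ (Fin d)),
      (∀ i, 0 ≤ t i) ∧
      (∀ (x : APWVar d I J L) (ρ : I → Option (J ⊕ L) → ℝ),
        -(x.alpha + ∑ j, D.mu j * x.beta j) = ∑ i, t i * (∑ b, ρ i b - x.alpha) +
          θ (fun i => ∑ b, x.dualVec i b) + ∑ i, ∑ b, (inner ℝ (x.dualVec i b) (v i b) -
            s i b * (x.weight i b - APWVar.weight (0 : APWVar d I J L) i b) - ν i b * ρ i b)) ∧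
      W ≤ -∑ i, s i none ∧
      ∀ i b z (r : ℝ), conj (D.block i b) z = r → inner ℝ z (v i b) - ν i b * r ≤ s i b := by
  choose ρ hmodel hsum using exists_isConicModel_conj_block_of_apw hf hx
  obtain ⟨t, θ, ν, s, v, ht, -, hl, hle, hdual⟩ := exists_conic_certificate
    (f := fun k : I × Option (J ⊕ L) => conj (D.block k.1 k.2)) (x₀ := (x, ρ)) (c := -W)
    (A := fun k => (APWVar.isLinearMap_dualVec k.1 k.2).mk' _ ∘ₗ LinearMap.fst ..)
    (B := fun k => (APWVar.isLinearMap_weight_sub_weight_zero k.1 k.2).mk' _ ∘ₗ LinearMap.fst ..)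
    (b := fun k => APWVar.weight (0 : APWVar d I J L) k.1 k.2)
    (R := fun k => LinearMap.proj k.2 ∘ₗ LinearMap.proj k.1 ∘ₗ LinearMap.snd ..)
    (p := fun i => (APWVar.isLinearMap_sum_sub_alpha i).mk' _) (a := (0 : I → ℝ))
    (Q := APWVar.isLinearMap_sum_dualVec.mk' _ ∘ₗ LinearMap.fst ..) (e := 0)
    (l := (APWVar.isLinearMap_neg_alpha_add_sum D.mu).mk' _ ∘ₗ LinearMap.fst ..)
    (fun k => (hf k.1 k.2).isProper_conj.1) (fun k => by simpa using hmodel k.1 k.2)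
    (fun i => sub_nonpos.2 (hsum i)) (funext ((mem_apwConstraints_iff hf).1 hx.mem).2.2.1)
    (by
      rintro ⟨x, ρ⟩ hsum heqn hepi
      have hepi i b : 0 < x.weight i b ∧
          persp (conj (D.block i b)) (x.dualVec i b) (x.weight i b) ≤ ρ i b := by
        simpa [perspEpi] using hepi (i, b)
      exact neg_le_neg <| hW x <| (mem_apwConstraints_iff hf).2
        ⟨fun j => (hepi (Classical.arbitrary I) (some (.inl j))).1.le,
          fun i l => (hepi i (some (.inr l))).1.le, congrFun heqn,
          fun i => ⟨ρ i, fun b => (hepi i b).2, sub_nonpos.1 (hsum i)⟩⟩)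
  refine ⟨t, θ, fun i b => ν (i, b), fun i b => s (i, b), fun i b => v (i, b), ht,
    fun x ρ => ?_, ?_, fun i b => hdual (i, b)⟩
  · simpa [Fintype.sum_prod_type] using hl (x, ρ)
  · have : ∑ i, s (i, none) ≤ -W := by
      simpa [Fintype.sum_prod_type, Fintype.sum_option, APWVar.weight, APWVar.beta, APWVar.nu]
        using hle
    linarith

theorem exists_le_adb_of_isSlaterPoint_apw (hf : ∀ i b, IsPCC (D.block i b))
    {x : APWVar d I J L} (hx : D.apwConstraints.IsSlaterPoint x) {W : ℝ}
    (hW : ∀ x ∈ D.apwConstraints.set, W ≤ x.alpha + ∑ j, D.mu j * x.beta j) :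
    ∃ y ∈ D.adbConstraints.set, W ≤ ∑ i, y.tau i := by
  classical
  obtain ⟨t, θ, ν, s, v, ht, hl, hle, hdual⟩ := exists_multipliers_of_isSlaterPoint_apw hf hx hW
  have hθ : θ (fun _ => 0) = 0 := θ.map_zero
  have hν (i : I) (b : Option (J ⊕ L)) : ν i b = t i := by
    have := hl 0 (Pi.single i (Pi.single b 1))
    rcases b with _ | j | l <;>
      simp [APWVar.alpha, APWVar.beta, APWVar.dualVec, APWVar.y0, APWVar.y1, APWVar.y2,
        Fintype.sum_option, Fintype.sum_sum_type, Pi.single_apply, ite_apply, hθ] at this <;>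
      linarith
  have ht_sum : ∑ i, t i = 1 := by
    have := hl (1, 0, 0, 0, 0, 0) 0
    simp [APWVar.alpha, APWVar.beta, APWVar.nu, APWVar.weight, APWVar.dualVec, APWVar.y0, APWVar.y1,
      APWVar.y2, Fintype.sum_option, hθ] at this
    linarith
  have hmoment (j : J) : ∑ i, s i (some (.inl j)) = D.mu j := by
    have := hl (0, Pi.single j 1, 0, 0, 0, 0) 0
    simp [APWVar.alpha, APWVar.beta, APWVar.nu, APWVar.weight, APWVar.dualVec, APWVar.y0, APWVar.y1,
      APWVar.y2, Fintype.sum_option, Pi.single_apply, hθ] at this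
    linarith
  have hsupp (i : I) (l : L) : s i (some (.inr l)) = 0 := by
    have := hl (0, 0, 0, 0, 0, Pi.single i (Pi.single l 1)) 0
    simpa [APWVar.alpha, APWVar.beta, APWVar.nu, APWVar.weight, APWVar.dualVec, APWVar.y0,
      APWVar.y1, APWVar.y2, Fintype.sum_option, Pi.single_apply, ite_apply, hθ] using this
  have hvec (i : I) (b : Option (J ⊕ L)) : v i b = v i none :=
    eq_of_forall_sum_inner_eq_zero (fun z hz => by
      have := hl (.ofDualVec 0 0 0 z) 0
      simp only [APWVar.dualVec_ofDualVec, funext hz, hθ, Finset.sum_sub_distrib] at this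
      simpa [APWVar.weight, APWVar.ofDualVec, APWVar.alpha, APWVar.beta, APWVar.nu] using
        this.symm) i b none
  let y : ADBVar d I J :=
    (fun i => -s i none, t, fun i j => s i (some (.inl j)), fun i => v i none)
  have hlevel i : ∀ b, y.level i b = s i b
    | none => neg_neg _
    | some (.inl j) => rfl
    | some (.inr l) => (hsupp i l).symm
  refine ⟨y, mem_adbConstraints_iff.2 ⟨ht_sum, fun j => (hmoment j).le, ht, fun i b => ?_⟩, ?_⟩
  · rw [hlevel]
    refine (hf i b).persp_le_of_conj (ht i) fun w c hc => ?_
    simpa only [y, ADBVar.ups, ADBVar.lam, hν, hvec i b] using hdual i b w c hc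
  · simpa [y, ADBVar.tau] using hle

end Data

/-! ### Weak duality and reformulations -/

/-- The change of variables `(λ, z, u, t) ↦ (λt, λ, λu, λz)` that takes (AD-B) to (AD-B'). -/
def ADBVar.ofAug {d : ℕ} {I J : Type*} (lam : I → ℝ)
    (p : I → EuclideanSpace ℝ (Fin d) × (J → ℝ) × ℝ) : ADBVar d I J :=
  (fun i => lam i * (p i).2.2, lam, fun i j => lam i * (p i).2.1 j, fun i => lam i • (p i).1)

theorem ADBVar.level_ofAug {d : ℕ} {I J L : Type*} (lam : I → ℝ)
    (p : I → EuclideanSpace ℝ (Fin d) × (J → ℝ) × ℝ) (i : I) (b : Option (J ⊕ L)) :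
    (ofAug lam p).level i b = lam i * (ofAug 1 p).level i b := by
  rcases b with _ | _ | _ <;> simp [ofAug, level, tau, omega]

namespace Data

section

variable {d : ℕ} {I J L : Type*} {D : Data d I J L}

theorem mem_augSupport_iff {p : I → EuclideanSpace ℝ (Fin d) × (J → ℝ) × ℝ} {i : I} :
    p i ∈ D.augSupport i ↔ ∀ b, D.block i b (p i).1 ≤ (ADBVar.ofAug 1 p).level i b := by
  simp only [augSupport, Set.mem_ofPred_eq, Option.forall, Sum.forall, block, ADBVar.level,
    ADBVar.ofAug, ADBVar.tau, ADBVar.omega, Pi.one_apply, one_mul, EReal.coe_neg,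
    EReal.neg_le_neg_iff, EReal.coe_zero]
  tauto

theorem mem_effSupport_iff {z : EuclideanSpace ℝ (Fin d)} :
    z ∈ D.effSupport ↔ z ∈ D.support ∧ (∀ j, D.h j z < ⊤) ∧ ⊥ < D.disutility z := by
  simp only [effSupport, effSupportPiece, dom, disutility, Set.mem_iUnion, Set.mem_ofPred_eq,
    lt_iSup_iff, exists_and_left, EReal.neg_lt_comm (b := ⊤), EReal.neg_top]

theorem mem_effSupport_of_mem_augSupport {i : I} {p : EuclideanSpace ℝ (Fin d) × (J → ℝ) × ℝ}
    (hp : p ∈ D.augSupport i) : p.1 ∈ D.effSupport :=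
  mem_effSupport_iff.2 ⟨hp.1, fun j => (hp.2.1 j).trans_lt (EReal.coe_lt_top _),
    (EReal.bot_lt_coe _).trans_le <| hp.2.2.trans <| le_iSup (fun i => D.g i p.1) i⟩

theorem coe_toReal_h (hf : ∀ i b, IsPCC (D.block i b)) {z : EuclideanSpace ℝ (Fin d)}
    (hz : z ∈ D.effSupport) (j : J) : ((D.h j z).toReal : EReal) = D.h j z := by
  obtain ⟨i, -⟩ := Set.mem_iUnion.1 hz
  exact EReal.coe_toReal ((mem_effSupport_iff.1 hz).2.1 j).ne
    ((hf i (some (.inl j))).proper.1 z).ne'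

theorem toReal_h_le_of_mem_augSupport (hf : ∀ i b, IsPCC (D.block i b)) {i : I}
    {p : EuclideanSpace ℝ (Fin d) × (J → ℝ) × ℝ} (hp : p ∈ D.augSupport i) (j : J) :
    (D.h j p.1).toReal ≤ p.2.1 j := by
  rw [← EReal.coe_le_coe_iff, coe_toReal_h hf (mem_effSupport_of_mem_augSupport hp)]
  exact hp.2.1 j

end

section Finite

variable {d : ℕ} {I J L : Type*} [Finite I] {D : Data d I J L}

theorem disutility_lt_top (hf : ∀ i b, IsPCC (D.block i b)) (z : EuclideanSpace ℝ (Fin d)) :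
    D.disutility z < ⊤ := by
  cases nonempty_fintype I
  rw [disutility, ← Finset.sup_univ_eq_iSup, Finset.sup_lt_iff bot_lt_top]
  intro i _
  rw [← EReal.neg_bot, EReal.lt_neg_comm]
  exact (hf i none).proper.1 z

theorem coe_toReal_disutility (hf : ∀ i b, IsPCC (D.block i b)) {z : EuclideanSpace ℝ (Fin d)}
    (hz : z ∈ D.effSupport) : ((D.disutility z).toReal : EReal) = D.disutility z :=
  EReal.coe_toReal (disutility_lt_top hf z).ne (mem_effSupport_iff.1 hz).2.2.ne'

theorem le_toReal_disutility_of_mem_augSupport (hf : ∀ i b, IsPCC (D.block i b)) {i : I}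
    {p : EuclideanSpace ℝ (Fin d) × (J → ℝ) × ℝ} (hp : p ∈ D.augSupport i) :
    p.2.2 ≤ (D.disutility p.1).toReal := by
  rw [← EReal.coe_le_coe_iff, coe_toReal_disutility hf (mem_effSupport_of_mem_augSupport hp)]
  exact hp.2.2.trans (le_iSup (fun i => D.g i p.1) i)

theorem exists_mem_augSupport_toReal (hf : ∀ i b, IsPCC (D.block i b))
    {z : EuclideanSpace ℝ (Fin d)} (hz : z ∈ D.effSupport) :
    ∃ i, (z, fun j => (D.h j z).toReal, (D.disutility z).toReal) ∈ D.augSupport i := by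
  have : Nonempty I := (Set.mem_iUnion.1 hz).nonempty
  obtain ⟨i, hi⟩ := exists_eq_ciSup_of_finite (f := fun i => D.g i z)
  refine ⟨i, (mem_effSupport_iff.1 hz).1, fun j => (coe_toReal_h hf hz j).ge, ?_⟩
  rw [coe_toReal_disutility hf hz]
  exact hi.ge

end Finite

section

variable {d : ℕ} {I J L : Type*} [Fintype J] {D : Data d I J L}

theorem mem_apwSet_iff {x : ℝ × (J → ℝ)} : x ∈ D.apwSet ↔
    (∀ i, ∀ p ∈ D.augSupport i, p.2.2 ≤ x.1 + ∑ j, p.2.1 j * x.2 j) ∧ ∀ j, 0 ≤ x.2 j := by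
  simp only [apwSet, Set.mem_ofPred_eq, iSup₂_le_iff, EReal.coe_nonpos,
    sub_le_iff_le_add', add_zero]

variable [Finite I]

theorem mem_duqSet_iff (hf : ∀ i b, IsPCC (D.block i b)) {x : ℝ × (J → ℝ)} : x ∈ D.duqSet ↔
    (∀ z ∈ D.effSupport, (D.disutility z).toReal ≤ x.1 + ∑ j, (D.h j z).toReal * x.2 j) ∧
      ∀ j, 0 ≤ x.2 j := by
  simp only [duqSet, Set.mem_ofPred_eq, iSup₂_le_iff]
  refine and_congr_left fun _ => forall₂_congr fun z hz => ?_
  have hreal : D.disutility z - (x.1 : EReal) - ∑ j, D.h j z * (x.2 j : EReal) =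
      (((D.disutility z).toReal - x.1 - ∑ j, (D.h j z).toReal * x.2 j : ℝ) : EReal) := by
    simp only [EReal.coe_sub, ereal_coe_sum, EReal.coe_mul, coe_toReal_disutility hf hz,
      coe_toReal_h hf hz]
  rw [hreal, EReal.coe_nonpos, sub_sub, sub_nonpos]

theorem apwSet_eq_duqSet (hf : ∀ i b, IsPCC (D.block i b)) : D.apwSet = D.duqSet := by
  ext x
  rw [mem_apwSet_iff, mem_duqSet_iff hf]
  refine and_congr_left fun hβ => ⟨fun h z hz => ?_, fun h i p hp => ?_⟩
  · obtain ⟨i, hi⟩ := exists_mem_augSupport_toReal hf hz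
    exact h i _ hi
  · calc p.2.2 ≤ (D.disutility p.1).toReal := le_toReal_disutility_of_mem_augSupport hf hp
      _ ≤ x.1 + ∑ j, (D.h j p.1).toReal * x.2 j := h _ (mem_effSupport_of_mem_augSupport hp)
      _ ≤ x.1 + ∑ j, p.2.1 j * x.2 j := by
        gcongr with j
        · exact hβ j
        · exact toReal_h_le_of_mem_augSupport hf hp j

end

section

variable {d : ℕ} {I J L : Type*} [Fintype J] [Fintype L] {D : Data d I J L}

theorem tau_le_of_persp_le (hf : ∀ i b, IsPCC (D.block i b)) {x : ADBVar d I J}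
    {y : APWVar d I J L} {i : I} {ρ : Option (J ⊕ L) → ℝ} (hlam : 0 ≤ x.lam i)
    (hx : ∀ b, persp (D.block i b) (x.ups i) (x.lam i) ≤ x.level i b)
    (hy : ∀ b, persp (conj (D.block i b)) (y.dualVec i b) (y.weight i b) ≤ ρ b)
    (hsum : ∑ b, y.dualVec i b = 0) (hρ : ∑ b, ρ b ≤ y.alpha) :
    x.tau i ≤ ∑ j, x.omega i j * y.beta j + x.lam i * y.alpha := by
  have h : ∑ b, inner ℝ (x.ups i) (y.dualVec i b) ≤
      ∑ b, (y.weight i b * x.level i b + x.lam i * ρ b) :=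
    Finset.sum_le_sum fun b _ => (hf i b).inner_le_of_persp_le (hx b) (hy b)
  rw [← inner_sum, hsum, inner_zero_right, Finset.sum_add_distrib, ← Finset.mul_sum,
    Fintype.sum_option, Fintype.sum_sum_type] at h
  simp only [APWVar.weight, ADBVar.level, mul_zero, Finset.sum_const_zero, add_zero, one_mul] at h
  simp only [mul_comm (x.omega i _)]
  linarith [mul_le_mul_of_nonneg_left hρ hlam]

theorem mem_apwSet_of_mem_apwConstraints (hf : ∀ i b, IsPCC (D.block i b)) {x : APWVar d I J L}
    (hx : x ∈ D.apwConstraints.set) : (x.alpha, x.beta) ∈ D.apwSet := by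
  obtain ⟨hβ, -, hsum, hpiece⟩ := (mem_apwConstraints_iff hf).1 hx
  refine mem_apwSet_iff.2 ⟨fun i p hp => ?_, hβ⟩
  obtain ⟨ρ, hρ, hα⟩ := hpiece i
  have := tau_le_of_persp_le (x := .ofAug 1 fun _ => p) hf zero_le_one
    (fun b => by simpa [ADBVar.ofAug, ADBVar.lam, ADBVar.ups, persp_one]
      using mem_augSupport_iff (p := fun _ => p).1 hp b) hρ (hsum i) hα
  simpa [ADBVar.ofAug, ADBVar.tau, ADBVar.omega, ADBVar.lam, add_comm] using this

variable [Fintype I]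

theorem adb_le_apw (hf : ∀ i b, IsPCC (D.block i b)) {x : ADBVar d I J} {y : APWVar d I J L}
    (hx : x ∈ D.adbConstraints.set) (hy : y ∈ D.apwConstraints.set) :
    ∑ i, x.tau i ≤ y.alpha + ∑ j, D.mu j * y.beta j := by
  obtain ⟨hlam, hmu, hlam_nonneg, hpersp⟩ := mem_adbConstraints_iff.1 hx
  obtain ⟨hβ, -, hsum, hpiece⟩ := (mem_apwConstraints_iff hf).1 hy
  calc ∑ i, x.tau i ≤ ∑ i, (∑ j, x.omega i j * y.beta j + x.lam i * y.alpha) :=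
        Finset.sum_le_sum fun i _ => by
          obtain ⟨ρ, hρ, hα⟩ := hpiece i
          exact tau_le_of_persp_le hf (hlam_nonneg i) (hpersp i) hρ (hsum i) hα
    _ = y.alpha + ∑ j, (∑ i, x.omega i j) * y.beta j := by
        rw [Finset.sum_add_distrib, ← Finset.sum_mul, hlam, one_mul, Finset.sum_comm, add_comm]
        simp only [Finset.sum_mul]
    _ ≤ y.alpha + ∑ j, D.mu j * y.beta j := by
        gcongr with j
        · exact hβ j
        · exact hmu j

end

section

variable {d : ℕ} {I J L : Type*} [Fintype I] {D : Data d I J L}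

theorem sum_mul_h_eq_coe (hf : ∀ i b, IsPCC (D.block i b)) {z : I → EuclideanSpace ℝ (Fin d)}
    (hz : ∀ i, z i ∈ D.effSupport) (lam : I → ℝ) (j : J) :
    ∑ i, (lam i : EReal) * D.h j (z i) = ((∑ i, lam i * (D.h j (z i)).toReal : ℝ) : EReal) := by
  simp only [ereal_coe_sum, EReal.coe_mul, coe_toReal_h hf (hz _)]

theorem frObj_eq_coe (hf : ∀ i b, IsPCC (D.block i b))
    {x : (I → ℝ) × (I → EuclideanSpace ℝ (Fin d))} (hx : x ∈ D.frSet) :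
    D.frObj x = ((∑ i, x.1 i * (D.disutility (x.2 i)).toReal : ℝ) : EReal) := by
  simp only [frObj, ereal_coe_sum, EReal.coe_mul, coe_toReal_disutility hf (hx.2.2.1 _)]

theorem mem_frSet_of_mem_adbSet (hf : ∀ i b, IsPCC (D.block i b))
    {x : (I → ℝ) × (I → EuclideanSpace ℝ (Fin d) × (J → ℝ) × ℝ)} (hx : x ∈ D.adbSet) :
    (x.1, fun i => (x.2 i).1) ∈ D.frSet := by
  obtain ⟨hsum, hmu, hmem, hnonneg⟩ := hx
  have hz i := mem_effSupport_of_mem_augSupport (hmem i)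
  refine ⟨hsum, fun j => ?_, hz, hnonneg⟩
  rw [sum_mul_h_eq_coe hf hz, EReal.coe_le_coe_iff]
  exact (Finset.sum_le_sum fun i _ => mul_le_mul_of_nonneg_left
    (toReal_h_le_of_mem_augSupport hf (hmem i) j) (hnonneg i)).trans (hmu j)

theorem adbObj_le_frObj (hf : ∀ i b, IsPCC (D.block i b))
    {x : (I → ℝ) × (I → EuclideanSpace ℝ (Fin d) × (J → ℝ) × ℝ)} (hx : x ∈ D.adbSet) :
    D.adbObj x ≤ D.frObj (x.1, fun i => (x.2 i).1) := by
  rw [frObj_eq_coe hf (mem_frSet_of_mem_adbSet hf hx), adbObj, EReal.coe_le_coe_iff]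
  obtain ⟨-, -, hmem, hnonneg⟩ := hx
  exact Finset.sum_le_sum fun i _ => mul_le_mul_of_nonneg_left
    (le_toReal_disutility_of_mem_augSupport hf (hmem i)) (hnonneg i)

theorem ofAug_mem_adbConstraints
    {x : (I → ℝ) × (I → EuclideanSpace ℝ (Fin d) × (J → ℝ) × ℝ)} (hx : x ∈ D.adbSet) :
    ADBVar.ofAug x.1 x.2 ∈ D.adbConstraints.set := by
  obtain ⟨hsum, hmu, hmem, hnonneg⟩ := hx
  refine mem_adbConstraints_iff.2 ⟨hsum, hmu, hnonneg, fun i b => ?_⟩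
  rw [ADBVar.level_ofAug]
  change persp (D.block i b) (x.1 i • (x.2 i).1) (x.1 i) ≤ _
  rcases (hnonneg i).eq_or_lt with hzero | hpos
  · rw [← hzero, zero_smul, zero_mul, persp_zero_le_iff]
    simp
  · rw [persp_smul hpos, EReal.coe_mul]
    exact mul_le_mul_of_nonneg_left (mem_augSupport_iff.1 (hmem i) b) (EReal.coe_nonneg.2 hpos.le)

end

end Data

/-! ### Expectations -/

section Expectation

variable {Ω : Type*} [MeasurableSpace Ω] {P : Measure Ω} {f : Ω → EReal}

theorem toReal_toENNReal_eq_max (x : EReal) : x.toENNReal.toReal = max x.toReal 0 := by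
  induction x with
  | bot => simp
  | coe r => simp [ENNReal.toReal_ofReal']
  | top => simp

theorem expectBot_eq_neg_expectTop : expectBot P f = -expectTop P (fun z => -f z) := by
  simp only [expectBot, expectTop, neg_neg, and_comm (a := ∫⁻ z, (-f z).toENNReal ∂P = ⊤)]
  split_ifs with h
  · rfl
  · rw [EReal.neg_sub (.inl (EReal.coe_ennreal_ne_bot _)), sub_eq_add_neg, add_comm]
    rw [Ne, Ne, EReal.coe_ennreal_eq_top_iff, EReal.coe_ennreal_eq_top_iff]
    tauto

theorem expectTop_eq_integral {r : Ω → ℝ} (h : ∀ᵐ z ∂P, f z = r z) (hr : Integrable r P) :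
    expectTop P f = ((∫ z, r z ∂P : ℝ) : EReal) := by
  have hpos : ∫⁻ z, (f z).toENNReal ∂P = ∫⁻ z, ENNReal.ofReal (r z) ∂P :=
    lintegral_congr_ae <| h.mono fun z hz => by simp only [hz, EReal.real_coe_toENNReal]
  have hneg : ∫⁻ z, (-f z).toENNReal ∂P = ∫⁻ z, ENNReal.ofReal (-r z) ∂P :=
    lintegral_congr_ae <| h.mono fun z hz => by
      simp only [hz, ← EReal.coe_neg, EReal.real_coe_toENNReal]
  have hpos_lt := hr.lintegral_lt_top
  have hneg_lt : ∫⁻ z, ENNReal.ofReal (-r z) ∂P < ⊤ := hr.neg.lintegral_lt_top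
  rw [expectTop, hpos, hneg, if_neg fun h => hpos_lt.ne h.1,
    integral_eq_lintegral_pos_part_sub_lintegral_neg_part hr, EReal.coe_sub,
    EReal.coe_ennreal_toReal hpos_lt.ne, EReal.coe_ennreal_toReal hneg_lt.ne]

theorem expectBot_eq_integral {r : Ω → ℝ} (h : ∀ᵐ z ∂P, f z = r z) (hr : Integrable r P) :
    expectBot P f = ((∫ z, r z ∂P : ℝ) : EReal) := by
  rw [expectBot_eq_neg_expectTop, expectTop_eq_integral (r := fun z => -r z) _ hr.neg,
    integral_neg, EReal.coe_neg, neg_neg]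
  exact h.mono fun z hz => by rw [hz, EReal.coe_neg]

theorem lintegral_toENNReal_ne_top_of_expectTop_ne_top (h : expectTop P f ≠ ⊤) :
    ∫⁻ z, (f z).toENNReal ∂P ≠ ⊤ := by
  intro hpos
  refine h ?_
  rw [expectTop]
  split_ifs with hneg
  · rfl
  · have hneg : ∫⁻ z, (-f z).toENNReal ∂P ≠ ⊤ := fun h => hneg ⟨hpos, h⟩
    rw [hpos, ← EReal.coe_ennreal_toReal hneg, EReal.coe_ennreal_top, EReal.top_sub_coe]

theorem ae_lt_top_of_expectTop_ne_top (hf : Measurable f) (h : expectTop P f ≠ ⊤) :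
    ∀ᵐ z ∂P, f z < ⊤ :=
  (ae_lt_top hf.ereal_toENNReal (lintegral_toENNReal_ne_top_of_expectTop_ne_top h)).mono
    fun _ hz => (EReal.toENNReal_ne_top_iff.1 hz.ne).lt_top

theorem integrable_max_toReal_of_expectTop_ne_top (hf : Measurable f) (h : expectTop P f ≠ ⊤) :
    Integrable (fun z => max (f z).toReal 0) P := by
  simp only [← toReal_toENNReal_eq_max]
  exact integrable_toReal_of_lintegral_ne_top hf.ereal_toENNReal.aemeasurable
    (lintegral_toENNReal_ne_top_of_expectTop_ne_top h)

theorem integrable_of_ae_le_add_sum {ι : Type*} [Fintype ι] {G a : Ω → ℝ} {F : ι → Ω → ℝ}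
    (hG : AEStronglyMeasurable G P) (hF : ∀ i, AEStronglyMeasurable (F i) P)
    (ha : Integrable a P) (hG_neg : Integrable (fun z => max (-G z) 0) P)
    (hF_pos : ∀ i, Integrable (fun z => max (F i z) 0) P)
    (hle : ∀ᵐ z ∂P, G z ≤ a z + ∑ i, F i z) : Integrable G P ∧ ∀ i, Integrable (F i) P := by
  have hsum : Integrable (fun z => ∑ i, max (F i z) 0) P :=
    integrable_finsetSum _ fun i _ => hF_pos i
  have hG_int : Integrable G P := by
    refine integrable_of_le_of_le hG (.of_forall fun z => ?_) (hle.mono fun z hz => ?_)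
      hG_neg.neg (ha.add hsum)
    · exact neg_le.1 (le_max_left (-G z) 0)
    · exact hz.trans (add_le_add_right (Finset.sum_le_sum fun i _ => le_max_left _ _) _)
  refine ⟨hG_int, fun i => integrable_of_le_of_le (hF i) (hle.mono fun z hz => ?_)
    (.of_forall fun z => le_max_left _ _) ((hG_int.sub ha).sub hsum) (hF_pos i)⟩
  have hsingle : max (F i z) 0 - F i z ≤ ∑ k, (max (F k z) 0 - F k z) :=
    Finset.single_le_sum (f := fun k => max (F k z) 0 - F k z)
      (fun k _ => sub_nonneg.2 (le_max_left _ _)) (Finset.mem_univ i)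
  rw [Finset.sum_sub_distrib] at hsingle
  change G z - a z - ∑ k, max (F k z) 0 ≤ F i z
  linarith [le_max_right (F i z) 0]

end Expectation

section FiniteSupport

variable {Ω ι : Type*} [MeasurableSpace Ω] [MeasurableSingletonClass Ω] [Fintype ι]
  {w : ι → ENNReal} {z : ι → Ω}

theorem ae_sum_smul_dirac {p : Ω → Prop} (hp : ∀ i, p (z i)) :
    ∀ᵐ x ∂∑ i, w i • Measure.dirac (z i), p x :=
  ae_finsetSum_measure_iff.2 fun i _ => Measure.ae_smul_measure (by simpa using hp i) _

theorem integrable_sum_smul_dirac (hw : ∀ i, w i ≠ ⊤) (r : Ω → ℝ) :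
    Integrable r (∑ i, w i • Measure.dirac (z i)) :=
  integrable_finsetSum_measure.2 fun i _ => (integrable_dirac (by simp)).smul_measure (hw i)

theorem integral_sum_smul_dirac (hw : ∀ i, w i ≠ ⊤) (r : Ω → ℝ) :
    ∫ x, r x ∂(∑ i, w i • Measure.dirac (z i)) = ∑ i, (w i).toReal * r (z i) := by
  rw [← Measure.sum_fintype, integral_sum_dirac hw, tsum_fintype]
  simp only [smul_eq_mul]

end FiniteSupport

namespace Data

section WeakDuality

variable {d : ℕ} {I J L : Type*} {D : Data d I J L}

theorem measurable_block (hf : ∀ i b, IsPCC (D.block i b)) (i : I) (b : Option (J ⊕ L)) :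
    Measurable (D.block i b) :=
  (hf i b).closed.1.measurable

theorem measurable_h [Nonempty I] (hf : ∀ i b, IsPCC (D.block i b)) (j : J) :
    Measurable (D.h j) :=
  measurable_block hf (Classical.arbitrary I) (some (.inl j))

theorem measurable_disutility [Countable I] (hf : ∀ i b, IsPCC (D.block i b)) :
    Measurable D.disutility :=
  Measurable.iSup fun i => by
    simpa only [block, Pi.neg_def, neg_neg] using (measurable_block hf i none).neg

variable {P : Measure (EuclideanSpace ℝ (Fin d))}

theorem expectTop_h_ne_top (hP : P ∈ D.ambiguitySet) (j : J) : expectTop P (D.h j) ≠ ⊤ :=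
  ((hP.2.2 j).trans_lt (EReal.coe_lt_top _)).ne

theorem expectTop_neg_disutility_ne_top (hbot : D.puqObj P ≠ ⊥) :
    expectTop P (fun z => -D.disutility z) ≠ ⊤ := by
  rwa [puqObj, expectBot_eq_neg_expectTop, Ne, EReal.neg_eq_bot_iff] at hbot

variable [Nonempty I]

theorem ae_mem_effSupport [Countable I] [Countable J] (hf : ∀ i b, IsPCC (D.block i b))
    (hP : P ∈ D.ambiguitySet) (hbot : D.puqObj P ≠ ⊥) : ∀ᵐ z ∂P, z ∈ D.effSupport := by
  have hh : ∀ᵐ z ∂P, ∀ j, D.h j z < ⊤ := ae_all_iff.2 fun j =>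
    ae_lt_top_of_expectTop_ne_top (measurable_h hf j) (expectTop_h_ne_top hP j)
  have hg : ∀ᵐ z ∂P, -D.disutility z < ⊤ :=
    ae_lt_top_of_expectTop_ne_top (measurable_disutility hf).neg
      (expectTop_neg_disutility_ne_top hbot)
  have hsupp : ∀ᵐ z ∂P, z ∈ D.support := hP.2.1
  filter_upwards [hsupp, hh, hg] with z hz_supp hz_h hz_g
  exact mem_effSupport_iff.2 ⟨hz_supp, hz_h, by simpa using EReal.neg_lt_comm.1 hz_g⟩

theorem integral_toReal_h_mul_le [Countable I] [Countable J]
    (hf : ∀ i b, IsPCC (D.block i b)) (hP : P ∈ D.ambiguitySet)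
    (hbot : D.puqObj P ≠ ⊥) {β : ℝ} (hβ : 0 ≤ β) {j : J}
    (hint : Integrable (fun z => (D.h j z).toReal * β) P) :
    ∫ z, (D.h j z).toReal * β ∂P ≤ D.mu j * β := by
  rcases hβ.eq_or_lt with rfl | hpos
  · simp
  · have hh : ∀ᵐ z ∂P, D.h j z = (D.h j z).toReal :=
      (ae_mem_effSupport hf hP hbot).mono fun z hz => (coe_toReal_h hf hz j).symm
    have hmoment := hP.2.2 j
    rw [expectTop_eq_integral hh ((integrable_mul_const_iff hpos.ne'.isUnit _).1 hint),
      EReal.coe_le_coe_iff] at hmoment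
    rw [integral_mul_const]
    exact mul_le_mul_of_nonneg_right hmoment hβ

variable [Finite I] [Fintype J]

theorem ae_disutility_le_of_mem_duqSet (hf : ∀ i b, IsPCC (D.block i b))
    (hP : P ∈ D.ambiguitySet) (hbot : D.puqObj P ≠ ⊥) {x : ℝ × (J → ℝ)} (hx : x ∈ D.duqSet) :
    ∀ᵐ z ∂P, (D.disutility z).toReal ≤ x.1 + ∑ j, (D.h j z).toReal * x.2 j :=
  (ae_mem_effSupport hf hP hbot).mono ((mem_duqSet_iff hf).1 hx).1

theorem integrable_of_mem_duqSet (hf : ∀ i b, IsPCC (D.block i b))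
    (hP : P ∈ D.ambiguitySet) (hbot : D.puqObj P ≠ ⊥) {x : ℝ × (J → ℝ)} (hx : x ∈ D.duqSet) :
    Integrable (fun z => (D.disutility z).toReal) P ∧
      ∀ j, Integrable (fun z => (D.h j z).toReal * x.2 j) P := by
  have := hP.1
  refine integrable_of_ae_le_add_sum
    (measurable_disutility hf).ereal_toReal.aestronglyMeasurable
    (fun j => ((measurable_h hf j).ereal_toReal.mul_const _).aestronglyMeasurable)
    (integrable_const x.1) ?_ (fun j => ?_) (ae_disutility_le_of_mem_duqSet hf hP hbot hx)
  · simpa only [Pi.neg_apply, EReal.toReal_neg_eq] using integrable_max_toReal_of_expectTop_ne_top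
      (measurable_disutility hf).neg (expectTop_neg_disutility_ne_top hbot)
  · have := (integrable_max_toReal_of_expectTop_ne_top (measurable_h hf j)
      (expectTop_h_ne_top hP j)).mul_const (x.2 j)
    simpa only [max_mul_of_nonneg _ _ (hx.2 j), zero_mul] using this

theorem puqObj_le_duqObj (hf : ∀ i b, IsPCC (D.block i b)) (hP : P ∈ D.ambiguitySet)
    {x : ℝ × (J → ℝ)} (hx : x ∈ D.duqSet) : D.puqObj P ≤ D.duqObj x := by
  by_cases hbot : D.puqObj P = ⊥
  · exact hbot ▸ bot_le
  have := hP.1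
  have hg : ∀ᵐ z ∂P, D.disutility z = (D.disutility z).toReal :=
    (ae_mem_effSupport hf hP hbot).mono fun z hz => (coe_toReal_disutility hf hz).symm
  obtain ⟨hg_int, hh_int⟩ := integrable_of_mem_duqSet hf hP hbot hx
  have hsum_int : Integrable (fun z => ∑ j, (D.h j z).toReal * x.2 j) P :=
    integrable_finsetSum _ fun j _ => hh_int j
  rw [puqObj, expectBot_eq_integral hg hg_int, duqObj, EReal.coe_le_coe_iff]
  calc ∫ z, (D.disutility z).toReal ∂P ≤ ∫ z, (x.1 + ∑ j, (D.h j z).toReal * x.2 j) ∂P :=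
        integral_mono_ae hg_int ((integrable_const _).add hsum_int)
          (ae_disutility_le_of_mem_duqSet hf hP hbot hx)
    _ = x.1 + ∑ j, ∫ z, (D.h j z).toReal * x.2 j ∂P := by
        rw [integral_add (integrable_const _) hsum_int, integral_const, probReal_univ, one_smul,
          integral_finsetSum _ fun j _ => hh_int j]
    _ ≤ x.1 + ∑ j, D.mu j * x.2 j := by
        gcongr with j
        exact integral_toReal_h_mul_le hf hP hbot (hx.2 j) (hh_int j)

end WeakDuality

section Discrete

variable {d : ℕ} {I J L : Type*} [Fintype I] {D : Data d I J L}
  {x : (I → ℝ) × (I → EuclideanSpace ℝ (Fin d))}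

theorem sum_smul_dirac_mem_ambiguitySet (hf : ∀ i b, IsPCC (D.block i b)) (hx : x ∈ D.frSet) :
    ∑ i, ENNReal.ofReal (x.1 i) • Measure.dirac (x.2 i) ∈ D.ambiguitySet := by
  obtain ⟨hsum, hmu, hmem, hnonneg⟩ := hx
  refine ⟨?_, ae_sum_smul_dirac (p := (· ∈ D.support)) fun i => (mem_effSupport_iff.1 (hmem i)).1,
    fun j => ?_⟩
  · rw [← Measure.sum_fintype]
    exact HasSum.isProbabilityMeasure_sum_dirac hnonneg (hsum ▸ hasSum_fintype x.1)
  · rw [expectTop_eq_integral (r := fun z => (D.h j z).toReal)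
      (ae_sum_smul_dirac fun i => (coe_toReal_h hf (hmem i) j).symm)
      (integrable_sum_smul_dirac (fun _ => ENNReal.ofReal_ne_top) _),
      integral_sum_smul_dirac fun _ => ENNReal.ofReal_ne_top]
    simp only [ENNReal.toReal_ofReal (hnonneg _)]
    exact (sum_mul_h_eq_coe hf hmem x.1 j).symm.trans_le (hmu j)

theorem puqObj_sum_smul_dirac (hf : ∀ i b, IsPCC (D.block i b)) (hx : x ∈ D.frSet) :
    D.puqObj (∑ i, ENNReal.ofReal (x.1 i) • Measure.dirac (x.2 i)) = D.frObj x := by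
  rw [frObj_eq_coe hf hx, puqObj, expectBot_eq_integral (r := fun z => (D.disutility z).toReal)
    (ae_sum_smul_dirac fun i => (coe_toReal_disutility hf (hx.2.2.1 i)).symm)
    (integrable_sum_smul_dirac (fun _ => ENNReal.ofReal_ne_top) _),
    integral_sum_smul_dirac fun _ => ENNReal.ofReal_ne_top]
  simp only [ENNReal.toReal_ofReal (hx.2.2.2 _)]

end Discrete

end Data

/-! ### Strong duality -/

section OptimalValue

variable {X : Type*} {C : Set X} {f : X → EReal} {x : X}

theorem minValue_le_of_mem (hx : x ∈ C) : minValue C f ≤ f x := iInf₂_le x hx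

theorem le_maxValue_of_mem (hx : x ∈ C) : f x ≤ maxValue C f := le_iSup₂ (f := fun x _ => f x) x hx

theorem solvesMin_iff : SolvesMin C f x ↔ (minValue C f ≠ ⊤ → x ∈ C ∧ f x = minValue C f) := by
  have hfeas : (∃ x', FeasibleMin C f x') ↔ minValue C f ≠ ⊤ := by
    simp [FeasibleMin, minValue]
  rw [SolvesMin, hfeas]
  exact forall_congr' fun h =>
    ⟨fun hx => ⟨hx.1.1, hx.2⟩, fun hx => ⟨⟨hx.1, hx.2 ▸ h⟩, hx.2⟩⟩

theorem solvesMax_iff : SolvesMax C f x ↔ (maxValue C f ≠ ⊥ → x ∈ C ∧ f x = maxValue C f) := by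
  have hfeas : (∃ x', FeasibleMax C f x') ↔ maxValue C f ≠ ⊥ := by
    simp [FeasibleMax, maxValue]
  rw [SolvesMax, hfeas]
  exact forall_congr' fun h =>
    ⟨fun hx => ⟨hx.1.1, hx.2⟩, fun hx => ⟨⟨hx.1, hx.2 ▸ h⟩, hx.2⟩⟩

end OptimalValue

theorem eq_zero_of_add_natCast_smul_mem_of_isBounded {E : Type*} [NormedAddCommGroup E]
    [NormedSpace ℝ E] {s : Set E} (hs : Bornology.IsBounded s) {z v : E}
    (h : ∀ n : ℕ, z + (n : ℝ) • v ∈ s) : v = 0 := by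
  obtain ⟨R, hR⟩ := hs.exists_norm_le
  by_contra hv
  obtain ⟨n, hn⟩ := exists_nat_gt ((R + ‖z‖) / ‖v‖)
  rw [div_lt_iff₀ (norm_pos_iff.2 hv)] at hn
  have hnv : n * ‖v‖ ≤ R + ‖z‖ := calc
    n * ‖v‖ = ‖z + (n : ℝ) • v - z‖ := by
      rw [add_sub_cancel_left, norm_smul, Real.norm_of_nonneg n.cast_nonneg]
    _ ≤ R + ‖z‖ := (norm_sub_le _ _).trans (by gcongr; exact hR _ (h n))
  exact hnv.not_gt hn

namespace Data

section

variable {d : ℕ} {I J L : Type*} {D : Data d I J L}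

theorem augSupport_nonempty (hf : ∀ i b, IsPCC (D.block i b)) {i : I}
    (hi : (D.effSupportPiece i).Nonempty) : (D.augSupport i).Nonempty := by
  obtain ⟨z, hc, hh, hg⟩ := hi
  choose u hu using fun j => (hf i (some (.inl j))).proper.exists_real (hh j)
  obtain ⟨r, hr⟩ := (hf i none).proper.exists_real hg
  refine ⟨(z, u, -r), hc, fun j => (hu j).le, ?_⟩
  rw [EReal.coe_neg, ← hr, block, neg_neg]

variable {x : ADBVar d I J} {i : I}

theorem smul_ups_mem_augSupport (hi : 0 < x.lam i)
    (hx : ∀ b, persp (D.block i b) (x.ups i) (x.lam i) ≤ x.level i b) :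
    ((x.lam i)⁻¹ • x.ups i, fun j => x.omega i j / x.lam i, x.tau i / x.lam i)
      ∈ D.augSupport i := by
  refine (mem_augSupport_iff (p := fun i =>
    ((x.lam i)⁻¹ • x.ups i, fun j => x.omega i j / x.lam i, x.tau i / x.lam i))).2 fun b =>
    ((persp_le_iff_of_pos hi).1 (hx b)).trans_eq ?_
  rcases b with _ | _ | _ <;>
    simp [ADBVar.level, ADBVar.ofAug, ADBVar.tau, ADBVar.omega, neg_div]

theorem level_nonneg_of_persp_zero_le (hf : ∀ i b, IsPCC (D.block i b)) {b : Option (J ⊕ L)}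
    (hx : persp (D.block i b) 0 0 ≤ x.level i b) : 0 ≤ x.level i b := by
  obtain ⟨w, hw⟩ := (hf i b).isProper_conj.2
  simpa only [inner_zero_right] using persp_zero_le_iff.1 hx w hw

theorem exists_mem_augSupport_of_persp_le (hf : ∀ i b, IsPCC (D.block i b))
    (hS : (D.effSupportPiece i).Nonempty) (hlam : 0 ≤ x.lam i)
    (hx : ∀ b, persp (D.block i b) (x.ups i) (x.lam i) ≤ x.level i b)
    (h0 : x.lam i = 0 → x.ups i = 0) :
    ∃ p ∈ D.augSupport i, x.tau i ≤ x.lam i * p.2.2 ∧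
      (∀ j, x.lam i * p.2.1 j ≤ x.omega i j) ∧ (0 < x.lam i → p.1 = (x.lam i)⁻¹ • x.ups i) := by
  rcases hlam.eq_or_lt with hi | hi
  · obtain ⟨p, hp⟩ := augSupport_nonempty hf hS
    have hlevel : ∀ b, 0 ≤ x.level i b := fun b =>
      level_nonneg_of_persp_zero_le hf (by simpa only [h0 hi.symm, ← hi] using hx b)
    rw [← hi]
    simp only [zero_mul, lt_self_iff_false, false_imp_iff, and_true]
    exact ⟨p, hp, neg_nonneg.1 (hlevel none), fun j => hlevel (some (.inl j))⟩
  · exact ⟨_, smul_ups_mem_augSupport hi hx, (mul_div_cancel₀ _ hi.ne').ge,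
      fun j => (mul_div_cancel₀ _ hi.ne').le, fun _ => rfl⟩

end

section

variable {d : ℕ} {I J L : Type*} [Fintype I] {D : Data d I J L} {x : ADBVar d I J}

theorem exists_mem_adbSet (hf : ∀ i b, IsPCC (D.block i b))
    (hS : ∀ i, (D.effSupportPiece i).Nonempty) (hx : x ∈ D.adbConstraints.set)
    (h0 : ∀ i, x.lam i = 0 → x.ups i = 0) :
    ∃ p, (x.lam, p) ∈ D.adbSet ∧ D.adbCvxObj x ≤ D.adbObj (x.lam, p) ∧
      ∀ i, 0 < x.lam i → (p i).1 = (x.lam i)⁻¹ • x.ups i := by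
  obtain ⟨hsum, hmu, hlam, hpersp⟩ := mem_adbConstraints_iff.1 hx
  choose p hp hτ hω hups using fun i =>
    exists_mem_augSupport_of_persp_le hf (hS i) (hlam i) (hpersp i) (h0 i)
  exact ⟨p, ⟨hsum, fun j => (Finset.sum_le_sum fun i _ => hω i j).trans (hmu j), hp, hlam⟩,
    EReal.coe_le_coe_iff.2 (Finset.sum_le_sum fun i _ => hτ i), hups⟩

theorem ups_eq_zero_of_lam_eq_zero (hf : ∀ i b, IsPCC (D.block i b))
    (hS : ∀ i, (D.effSupportPiece i).Nonempty) (hb : Bornology.IsBounded D.support)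
    (hx : x ∈ D.adbConstraints.set) {i : I} (h0 : x.lam i = 0) : x.ups i = 0 := by
  obtain ⟨-, -, -, hpersp⟩ := mem_adbConstraints_iff.1 hx
  obtain ⟨z, hz, -⟩ := hS i
  refine eq_zero_of_add_natCast_smul_mem_of_isBounded hb (z := z) fun n l => ?_
  have hray : persp (D.block i (some (.inr l))) (x.ups i) 0 ≤ ((0 : ℝ) : EReal) :=
    (congrArg (persp _ _) h0).symm.trans_le (hpersp i (some (.inr l)))
  have hle := (hf i (some (.inr l))).le_add_smul (r := 0) (hz l) hray n.cast_nonneg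
  rwa [mul_zero, add_zero] at hle

theorem discreteDist_eq {z : I → EuclideanSpace ℝ (Fin d)}
    (h : ∀ i, 0 < x.lam i → z i = (x.lam i)⁻¹ • x.ups i) :
    D.discreteDist x = ∑ i, ENNReal.ofReal (x.lam i) • Measure.dirac (z i) := by
  refine Finset.sum_congr rfl fun i _ => ?_
  split_ifs with hi
  · rw [h i hi]
  · rw [ENNReal.ofReal_of_nonpos (not_lt.1 hi), zero_smul]

theorem discreteDist_mem_ambiguitySet_and_adbCvxObj_le (hf : ∀ i b, IsPCC (D.block i b))
    (hS : ∀ i, (D.effSupportPiece i).Nonempty) (hb : Bornology.IsBounded D.support)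
    (hx : x ∈ D.adbConstraints.set) :
    D.discreteDist x ∈ D.ambiguitySet ∧ D.adbCvxObj x ≤ D.puqObj (D.discreteDist x) := by
  obtain ⟨p, hp, hle, hups⟩ :=
    exists_mem_adbSet hf hS hx fun i => ups_eq_zero_of_lam_eq_zero hf hS hb hx
  have hfr := mem_frSet_of_mem_adbSet hf hp
  rw [discreteDist_eq hups]
  exact ⟨sum_smul_dirac_mem_ambiguitySet hf hfr,
    (hle.trans (adbObj_le_frObj hf hp)).trans_eq (puqObj_sum_smul_dirac hf hfr).symm⟩

theorem maxValue_fr_le_maxValue_puq (hf : ∀ i b, IsPCC (D.block i b)) :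
    maxValue D.frSet D.frObj ≤ maxValue D.ambiguitySet D.puqObj :=
  iSup₂_le fun _ hx => (puqObj_sum_smul_dirac hf hx).symm.trans_le <|
    le_maxValue_of_mem (sum_smul_dirac_mem_ambiguitySet hf hx)

theorem maxValue_adb_le_maxValue_fr (hf : ∀ i b, IsPCC (D.block i b)) :
    maxValue D.adbSet D.adbObj ≤ maxValue D.frSet D.frObj :=
  iSup₂_le fun _ hx => (adbObj_le_frObj hf hx).trans <|
    le_maxValue_of_mem (mem_frSet_of_mem_adbSet hf hx)

theorem maxValue_adb_le_maxValue_adbCvx :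
    maxValue D.adbSet D.adbObj ≤ maxValue D.adbConstraints.set D.adbCvxObj :=
  iSup₂_le fun x hx =>
    le_maxValue_of_mem (f := D.adbCvxObj) (x := ADBVar.ofAug x.1 x.2) (ofAug_mem_adbConstraints hx)

end

section

variable {d : ℕ} {I J L : Type*} [Fintype J] {D : Data d I J L}

theorem minValue_apw_le_minValue_apwCvx [Fintype L]
    (hf : ∀ i b, IsPCC (D.block i b)) :
    minValue D.apwSet D.duqObj ≤ minValue D.apwConstraints.set D.apwCvxObj :=
  le_iInf₂ fun _ hx =>
    minValue_le_of_mem (f := D.duqObj) (mem_apwSet_of_mem_apwConstraints hf hx)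

theorem maxValue_puq_le_minValue_duq [Finite I] [Nonempty I]
    (hf : ∀ i b, IsPCC (D.block i b)) :
    maxValue D.ambiguitySet D.puqObj ≤ minValue D.duqSet D.duqObj :=
  iSup₂_le fun _ hP => le_iInf₂ fun _ hx => puqObj_le_duqObj hf hP hx

end

section

variable {d : ℕ} {I J L : Type*} [Fintype I] [Fintype J] [Fintype L] {D : Data d I J L}

theorem maxValue_adbCvx_le_minValue_apwCvx (hf : ∀ i b, IsPCC (D.block i b)) :
    maxValue D.adbConstraints.set D.adbCvxObj ≤ minValue D.apwConstraints.set D.apwCvxObj :=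
  iSup₂_le fun _ hx => le_iInf₂ fun _ hy => EReal.coe_le_coe_iff.2 (adb_le_apw hf hx hy)

/-- All weak duality gaps between the seven problems are nested inside the one between (AD-B) and
(AP-W'). -/
theorem sameValues_of_le [Nonempty I] (hf : ∀ i b, IsPCC (D.block i b))
    (h : minValue D.apwConstraints.set D.apwCvxObj ≤ maxValue D.adbSet D.adbObj) :
    D.SameValues := by
  have h_apw := minValue_apw_le_minValue_apwCvx hf
  have h_duq : minValue D.apwSet D.duqObj = minValue D.duqSet D.duqObj := by
    rw [apwSet_eq_duqSet hf]
  have h_puq := maxValue_puq_le_minValue_duq hf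
  have h_fr := maxValue_fr_le_maxValue_puq hf
  have h_adb := maxValue_adb_le_maxValue_fr hf
  have h_adbCvx := maxValue_adb_le_maxValue_adbCvx (D := D)
  have h_cvx := maxValue_adbCvx_le_minValue_apwCvx hf
  refine ⟨?_, ?_, ?_, ?_, ?_, ?_⟩ <;> order

theorem SameValues.minValue_apwCvx_eq_minValue_duq (h : D.SameValues) :
    minValue D.apwConstraints.set D.apwCvxObj = minValue D.duqSet D.duqObj :=
  h.1.trans h.2.1

theorem SameValues.maxValue_puq_eq_maxValue_adbCvx (h : D.SameValues) :
    maxValue D.ambiguitySet D.puqObj = maxValue D.adbConstraints.set D.adbCvxObj :=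
  h.2.2.2.1.trans (h.2.2.2.2.1.trans h.2.2.2.2.2)

theorem SameValues.minValue_apwCvx_eq_maxValue_adbCvx (h : D.SameValues) :
    minValue D.apwConstraints.set D.apwCvxObj = maxValue D.adbConstraints.set D.adbCvxObj :=
  h.minValue_apwCvx_eq_minValue_duq.trans (h.2.2.1.trans h.maxValue_puq_eq_maxValue_adbCvx)

theorem SameValues.minValue_apwCvx_eq_maxValue_adb (h : D.SameValues) :
    minValue D.apwConstraints.set D.apwCvxObj = maxValue D.adbSet D.adbObj :=
  h.minValue_apwCvx_eq_maxValue_adbCvx.trans h.2.2.2.2.2.symm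

theorem exists_apwCvxObj_le_maxValue_adb (hf : ∀ i b, IsPCC (D.block i b))
    (hS : ∀ i, (D.effSupportPiece i).Nonempty) {x : ADBVar d I J}
    (hx : D.adbConstraints.IsSlaterPoint x) (hpos : ∀ i, 0 < x.lam i)
    (htop : maxValue D.adbSet D.adbObj ≠ ⊤) :
    ∃ y ∈ D.apwConstraints.set, D.apwCvxObj y ≤ maxValue D.adbSet D.adbObj := by
  have hle : ∀ y ∈ D.adbConstraints.set, (∀ i, 0 < y.lam i) →
      D.adbCvxObj y ≤ maxValue D.adbSet D.adbObj := fun y hy hlam => by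
    obtain ⟨p, hp, hyp, -⟩ := exists_mem_adbSet hf hS hy fun i hi => absurd hi (hlam i).ne'
    exact hyp.trans (le_maxValue_of_mem hp)
  have hbot : maxValue D.adbSet D.adbObj ≠ ⊥ :=
    ((EReal.bot_lt_coe _).trans_le (hle x hx.mem hpos)).ne'
  lift maxValue D.adbSet D.adbObj to ℝ using ⟨htop, hbot⟩ with V
  obtain ⟨y, hy, hyV⟩ := exists_apw_le_of_isSlaterPoint_adb hf hx hpos
    fun y hy hlam => EReal.coe_le_coe_iff.1 (hle y hy hlam)
  exact ⟨y, hy, EReal.coe_le_coe_iff.2 hyV⟩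

theorem solvesMin_duq_of_solvesMin_apw (hf : ∀ i b, IsPCC (D.block i b))
    (hsame : D.SameValues) {x : APWVar d I J L}
    (hx : SolvesMin D.apwConstraints.set D.apwCvxObj x) :
    SolvesMin D.duqSet D.duqObj (x.alpha, x.beta) := by
  refine solvesMin_iff.2 fun hne => ?_
  have hval := hsame.minValue_apwCvx_eq_minValue_duq
  obtain ⟨hxmem, hxval⟩ := solvesMin_iff.1 hx (hval ▸ hne)
  exact ⟨apwSet_eq_duqSet hf ▸ mem_apwSet_of_mem_apwConstraints hf hxmem, hxval.trans hval⟩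

theorem solvesMax_puq_of_solvesMax_adb (hf : ∀ i b, IsPCC (D.block i b))
    (hS : ∀ i, (D.effSupportPiece i).Nonempty) (hb : Bornology.IsBounded D.support)
    (hsame : D.SameValues) {x : ADBVar d I J}
    (hx : SolvesMax D.adbConstraints.set D.adbCvxObj x) :
    SolvesMax D.ambiguitySet D.puqObj (D.discreteDist x) := by
  refine solvesMax_iff.2 fun hne => ?_
  have hval := hsame.maxValue_puq_eq_maxValue_adbCvx
  obtain ⟨hxmem, hxval⟩ := solvesMax_iff.1 hx (hval ▸ hne)
  obtain ⟨hmem, hle⟩ := discreteDist_mem_ambiguitySet_and_adbCvxObj_le hf hS hb hxmem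
  exact ⟨hmem, (le_maxValue_of_mem hmem).antisymm (hval.trans_le (hxval ▸ hle))⟩

variable [Nonempty I]

theorem exists_minValue_apwCvx_le_adbCvxObj (hf : ∀ i b, IsPCC (D.block i b))
    {x : APWVar d I J L} (hx : D.apwConstraints.IsSlaterPoint x)
    (hbot : minValue D.apwConstraints.set D.apwCvxObj ≠ ⊥) :
    ∃ y ∈ D.adbConstraints.set, minValue D.apwConstraints.set D.apwCvxObj ≤ D.adbCvxObj y := by
  have hle : ∀ y ∈ D.apwConstraints.set,
      minValue D.apwConstraints.set D.apwCvxObj ≤ D.apwCvxObj y := fun _ => minValue_le_of_mem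
  have htop : minValue D.apwConstraints.set D.apwCvxObj ≠ ⊤ :=
    ((hle x hx.mem).trans_lt (EReal.coe_lt_top _)).ne
  lift minValue D.apwConstraints.set D.apwCvxObj to ℝ using ⟨htop, hbot⟩ with W
  obtain ⟨y, hy, hyW⟩ := exists_le_adb_of_isSlaterPoint_apw hf hx
    fun y hy => EReal.coe_le_coe_iff.1 (hle y hy)
  exact ⟨y, hy, EReal.coe_le_coe_iff.2 hyW⟩

theorem strong_duality_of_isSlaterPoint_adb (hf : ∀ i b, IsPCC (D.block i b))
    (hS : ∀ i, (D.effSupportPiece i).Nonempty) {x : ADBVar d I J}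
    (hx : D.adbConstraints.IsSlaterPoint x) (hpos : ∀ i, 0 < x.lam i) :
    D.SameValues ∧ ∃ y, SolvesMin D.apwConstraints.set D.apwCvxObj y := by
  by_cases htop : maxValue D.adbSet D.adbObj = ⊤
  · have hsame := sameValues_of_le hf (htop ▸ le_top)
    exact ⟨hsame, 0, solvesMin_iff.2 fun hne =>
      absurd (hsame.minValue_apwCvx_eq_maxValue_adb.trans htop) hne⟩
  · obtain ⟨y, hy, hle⟩ := exists_apwCvxObj_le_maxValue_adb hf hS hx hpos htop
    have hmin : minValue D.apwConstraints.set D.apwCvxObj ≤ D.apwCvxObj y := minValue_le_of_mem hy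
    have hsame := sameValues_of_le hf (hmin.trans hle)
    exact ⟨hsame, y, solvesMin_iff.2 fun _ =>
      ⟨hy, (hle.trans_eq hsame.minValue_apwCvx_eq_maxValue_adb.symm).antisymm hmin⟩⟩

theorem strong_duality_of_isSlaterPoint_apw (hf : ∀ i b, IsPCC (D.block i b))
    (hS : ∀ i, (D.effSupportPiece i).Nonempty) (hb : Bornology.IsBounded D.support)
    {x : APWVar d I J L} (hx : D.apwConstraints.IsSlaterPoint x) :
    D.SameValues ∧ ∃ y, SolvesMax D.adbConstraints.set D.adbCvxObj y := by
  by_cases hbot : minValue D.apwConstraints.set D.apwCvxObj = ⊥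
  · have hsame := sameValues_of_le hf (hbot ▸ bot_le)
    exact ⟨hsame, 0, solvesMax_iff.2 fun hne =>
      absurd (hsame.minValue_apwCvx_eq_maxValue_adbCvx.symm.trans hbot) hne⟩
  · obtain ⟨y, hy, hle⟩ := exists_minValue_apwCvx_le_adbCvxObj hf hx hbot
    obtain ⟨p, hp, hyp, -⟩ :=
      exists_mem_adbSet hf hS hy fun i => ups_eq_zero_of_lam_eq_zero hf hS hb hy
    have hsame := sameValues_of_le hf (hle.trans (hyp.trans (le_maxValue_of_mem hp)))
    exact ⟨hsame, y, solvesMax_iff.2 fun _ => ⟨hy, (le_maxValue_of_mem hy).antisymm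
      (hsame.minValue_apwCvx_eq_maxValue_adbCvx.symm.trans_le hle)⟩⟩

end

end Data

end UQ

theorem mainTheorem2 {d : ℕ} {I J L : Type*} [Fintype I] [Nonempty I] [Fintype J] [Fintype L]
    (D : UQ.Data d I J L)
    (hG : ∀ i, UQ.IsPCC (fun z => -D.g i z))
    (hH : ∀ j, UQ.IsPCC (D.h j))
    (hC : ∀ l, UQ.IsPCC (D.c l))
    (hS : ∀ i, (D.effSupportPiece i).Nonempty) :
    ((∃ x, UQ.IsSlaterPointMax D.adbConstraints D.adbCvxObj x ∧ ∀ i, 0 < x.lam i) →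
      D.SameValues ∧
      (∃ x, UQ.SolvesMin D.apwConstraints.set D.apwCvxObj x) ∧
      ∀ x, UQ.SolvesMin D.apwConstraints.set D.apwCvxObj x →
        UQ.SolvesMin D.duqSet D.duqObj (x.alpha, x.beta)) ∧
    ((∃ x, UQ.IsSlaterPointMin D.apwConstraints D.apwCvxObj x) →
      Bornology.IsBounded D.support →
      D.SameValues ∧
      (∃ x, UQ.SolvesMax D.adbConstraints.set D.adbCvxObj x) ∧
      ∀ x, UQ.SolvesMax D.adbConstraints.set D.adbCvxObj x →
        UQ.SolvesMax D.ambiguitySet D.puqObj (D.discreteDist x)) := by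
  have hf := UQ.Data.isPCC_block D hG hH hC
  constructor
  · rintro ⟨x, hx, hpos⟩
    obtain ⟨hsame, hsol⟩ := UQ.Data.strong_duality_of_isSlaterPoint_adb hf hS hx.1 hpos
    exact ⟨hsame, hsol, fun y hy => UQ.Data.solvesMin_duq_of_solvesMin_apw hf hsame hy⟩
  · rintro ⟨x, hx⟩ hb
    obtain ⟨hsame, hsol⟩ := UQ.Data.strong_duality_of_isSlaterPoint_apw hf hS hb hx.1
    exact ⟨hsame, hsol, fun y hy => UQ.Data.solvesMax_puq_of_solvesMax_adb hf hS hb hsame hy⟩
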